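/- **Setting.** Let $\mathbf a_1,\dots,\mathbf a_n\in\mathbb R^d$ be data points with a partition of the index set $[n]$ into $K$ non-empty clusters $I_1,\dots,I_K$; $n_\alpha=|I_\alpha|$, $\mathbf a^{(\alpha)}=\frac1{n_\alpha}\sum_{i\in I_\alpha}\mathbf a_i$, $\mathbf a^{(0)}=\frac1n\sum_{i=1}^n\mathbf a_i$. Let $w_{ij}=w_{ji}\ge 0$ $(i\ne j)$ be weights, and put $$w^{(\alpha,\beta)}=\sum_{i\in I_\alpha}\sum_{j\in I_\beta}w_{ij},\quad \bar w^{(\beta)}=\frac1{n_\beta}\sum_{l\neq\beta}w^{(\beta,l)},\quad w_i^{(\beta)}=\sum_{j\in I_\beta}w_{ij},\quad \mu_{ij}^{(\alpha)}=\sum_{\beta\ne\alpha}\bigl|w_i^{(\beta)}-w_j^{(\beta)}\bigr|\ (i,j\in I_\alpha).$$ Assume that $\mathbf a^{(0)},\mathbf a^{(1)},\dots,\mathbf a^{(K)}$ are all distinct, that $w_{ij}>0$ and $n_\alpha w_{ij}>\mu^{(\alpha)}_{ij}$ for all $\alpha$ and all $i\neq j$ in $I_\alpha$, and that $n>K(K+1)$.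 Define $$\gamma_{\min}=\max_{\alpha}\max_{i,j\in I_\alpha}\frac{\|\mathbf a_i-\mathbf a_j\|}{n_\alpha w_{ij}-\mu_{ij}^{(\alpha)}},\quad \gamma_{\max}=\min_{\alpha<\beta}\frac{\|\mathbf a^{(\alpha)}-\mathbf a^{(\beta)}\|}{\bar w^{(\alpha)}+\bar w^{(\beta)}},\quad \gamma_{\max2}=\max_\alpha\frac{\|\mathbf a^{(0)}-\mathbf a^{(\alpha)}\|}{\bar w^{(\alpha)}},\quad r=\frac{\gamma_{\max}}{\gamma_{\min}},\quad r_2=\frac{\gamma_{\max2}}{\gamma_{\min}},$$ in $[0,\infty]$ (the terms with $i=j$ in $\gamma_{\min}$ are $0$; a positive quantity divided by $0$ is $\infty$). For $\Pi\in\mathbb R^{m\times d}$ and $\gamma\ge0$, let $(\hat{\mathbf x}^*_i(\gamma))_{i\in[n]}$ be the unique minimizer over $(\mathbb R^m)^n$ of $$\frac12\sum_{i=1}^n\|\hat{\mathbf x}_i-\Pi\mathbf a_i\|^2+\gamma\sum_{i<j}w_{ij}\|\hat{\mathbf x}_i-\hat{\mathbf x}_j\|.$$ The map $\hat\phi_\gamma:\mathbf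 a_i\mapsto\hat{\mathbf x}_i^*(\gamma)$ *perfectly recovers* a partition of $[n]$ if $\hat{\mathbf x}^*_i(\gamma)=\hat{\mathbf x}^*_j(\gamma)$ holds exactly when $i,j$ are in the same block. It *recovers a non-trivial coarsening* of the clustering if it perfectly recovers some partition of $[n]$ into $L>1$ blocks, each of which is a union of clusters. A probability distribution $D$ on $\mathbb R^{m\times d}$ is a *DJL distribution* $D_{\epsilon,\delta}$ if $\mathbb P_{\Pi\sim D}\bigl[\,\bigl|\|\Pi z\|^2-1\bigr|>\epsilon\bigr]<\delta$ for every $z\in\mathbb R^d$ with $\|z\|=1$. **Statement.** There is an absolute constant $C_0>0$ such that for every $C\ge C_0$ the following holds in every setting as above and for every real $p>2$ for which $\epsilon_{\min}:=\sqrt{C\,p\log(n)/d}<1$. Put $\epsilon_{\sup}=\frac{r^2-1}{r^2+1}$ and $\epsilon_{\sup2}=\frac{r_2^2-1}{r_2^2+1}$ (equal to $1$ if $r=\infty$, resp. $r_2=\infty$). 0. For every $0<\epsilon<1$ there are an integer $1\le m\le C\,p\,\epsilon^{-2}\log n$ and a DJL distribution $D_{\epsilon,\delta}$ on $\mathbb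 R^{m\times d}$ with $\delta=2/n^p$. For parts 1 and 2, let $\Pi$ be drawn from a DJL distribution $D_{\epsilon,\delta}$ on $\mathbb R^{m\times d}$ with $\delta=2/n^p$ and $1\le m\le C\,p\,\epsilon^{-2}\log n$, and let $E_1$ be the event that $$(1-\epsilon)\|\mathbf a_i-\mathbf a_j\|^2\le\|\Pi(\mathbf a_i-\mathbf a_j)\|^2\le(1+\epsilon)\|\mathbf a_i-\mathbf a_j\|^2\quad\text{for all }\alpha\text{ and all }i,j\in I_\alpha .$$ 1. If $r>\sqrt{\frac{1+\epsilon_{\min}}{1-\epsilon_{\min}}}$, then $\epsilon_{\min}<\epsilon_{\sup}$, and for every $\epsilon\in[\epsilon_{\min},\epsilon_{\sup})$, every such $m$ and $D_{\epsilon,\delta}$, and every real $\hat\gamma\in[\sqrt{1+\epsilon}\,\gamma_{\min},\sqrt{1-\epsilon}\,\gamma_{\max})$, $$\mathbb P\bigl[\hat\phi_{\hat\gamma}\text{ perfectly recovers the clusters }I_1,\dots,I_K\ \big|\ E_1\bigr]\ \ge\ 1-\frac1{n^{p-1}-n+1}.$$ 2. If $r_2>\sqrt{\frac{1+\epsilon_{\min}}{1-\epsilon_{\min}}}$,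 then $\epsilon_{\min}<\epsilon_{\sup2}$, and for every $\epsilon\in[\epsilon_{\min},\epsilon_{\sup2})$, every such $m$ and $D_{\epsilon,\delta}$, and every real $\hat\gamma\in[\sqrt{1+\epsilon}\,\gamma_{\min},\sqrt{1-\epsilon}\,\gamma_{\max2})$, $$\mathbb P\bigl[\hat\phi_{\hat\gamma}\text{ recovers a non-trivial coarsening of the clusters}\ \big|\ E_1\bigr]\ \ge\ 1-\frac1{n^{p-1}-n+1}.$$ -/

import Mathlib

open MeasureTheory ProbabilityTheory
open scoped NNReal ENNReal

noncomputable section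

namespace ConvexClustering

/-- The `ℓ²`-space `ℝ^d`. -/
abbrev E (d : ℕ) : Type := EuclideanSpace ℝ (Fin d)

/-! ### Data, clusters and weights

A collection of `n` data points is a family `a : Fin n → E d`, and its hidden partition into `K`
clusters is a labelling `c : Fin n → Fin K` (surjective: the clusters are non-empty). -/

/-- The index set `I_α` of the cluster `α`. -/
def idx {n K : ℕ} (c : Fin n → Fin K) (α : Fin K) : Finset (Fin n) :=
  Finset.univ.filter fun i => c i = α

/-- The size `n_α` of the cluster `α`. -/
def size {n K : ℕ} (c : Fin n → Fin K) (α : Fin K) : ℕ := (idx c α).card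

/-- The centroid `a^(α)` of the cluster `α`. -/
def centroid {n K d : ℕ} (a : Fin n → E d) (c : Fin n → Fin K) (α : Fin K) : E d :=
  (size c α : ℝ)⁻¹ • ∑ i ∈ idx c α, a i

/-- The mean `a^(0)` of all the data. -/
def mean {n d : ℕ} (a : Fin n → E d) : E d := (n : ℝ)⁻¹ • ∑ i, a i

/-- `w^(α, β)`, the total weight between the clusters `α` and `β`. -/
def clusterWeight {n K : ℕ} (w : Fin n → Fin n → ℝ) (c : Fin n → Fin K) (α β : Fin K) : ℝ :=
  ∑ i ∈ idx c α, ∑ j ∈ idx c β, w i j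

/-- `w̄^(β) = (1 / n_β) ∑_{l ≠ β} w^(β, l)`. -/
def avgWeight {n K : ℕ} (w : Fin n → Fin n → ℝ) (c : Fin n → Fin K) (β : Fin K) : ℝ :=
  (size c β : ℝ)⁻¹ * ∑ l ∈ Finset.univ.filter (fun l => l ≠ β), clusterWeight w c β l

/-- `w_i^(β)`, the total weight between the point `i` and the cluster `β`. -/
def pointWeight {n K : ℕ} (w : Fin n → Fin n → ℝ) (c : Fin n → Fin K) (i : Fin n) (β : Fin K) :
    ℝ :=
  ∑ j ∈ idx c β, w i j

/-- `μ_{ij}^(α) = ∑_{β ≠ α} |w_i^(β) - w_j^(β)|` (used for `i, j` in the cluster `α`). -/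
def weightGap {n K : ℕ} (w : Fin n → Fin n → ℝ) (c : Fin n → Fin K) (α : Fin K) (i j : Fin n) :
    ℝ :=
  ∑ β ∈ Finset.univ.filter (fun β => β ≠ α), |pointWeight w c i β - pointWeight w c j β|

/-- The mean and the centroids of the clusters are all distinct. -/
def DistinctCentroids {n K d : ℕ} (a : Fin n → E d) (c : Fin n → Fin K) : Prop :=
  Function.Injective (centroid a c) ∧ ∀ α, centroid a c α ≠ mean a

/-- The standing assumption on the weights inside the clusters. -/
def WeightCondition {n K : ℕ} (w : Fin n → Fin n → ℝ) (c : Fin n → Fin K) : Prop :=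
  ∀ α : Fin K, ∀ i ∈ idx c α, ∀ j ∈ idx c α, i ≠ j →
    0 < w i j ∧ weightGap w c α i j < (size c α : ℝ) * w i j

/-! ### The thresholds

They are extended nonnegative reals: a nonzero number divided by zero is `∞`, which happens when no
weight joins the clusters in question, or when the points of each cluster coincide. -/

/-- `γ_min`. -/
def gammaMin {n K d : ℕ} (a : Fin n → E d) (w : Fin n → Fin n → ℝ) (c : Fin n → Fin K) : ℝ≥0∞ :=
  ⨆ (α : Fin K) (i ∈ idx c α) (j ∈ idx c α),
    ENNReal.ofReal ‖a i - a j‖ / ENNReal.ofReal ((size c α : ℝ) * w i j - weightGap w c α i j)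

/-- `γ_max`. -/
def gammaMax {n K d : ℕ} (a : Fin n → E d) (w : Fin n → Fin n → ℝ) (c : Fin n → Fin K) : ℝ≥0∞ :=
  ⨅ (α : Fin K) (β : Fin K) (_ : α < β),
    ENNReal.ofReal ‖centroid a c α - centroid a c β‖ /
      ENNReal.ofReal (avgWeight w c α + avgWeight w c β)

/-- `γ_max2`. -/
def gammaMax2 {n K d : ℕ} (a : Fin n → E d) (w : Fin n → Fin n → ℝ) (c : Fin n → Fin K) : ℝ≥0∞ :=
  ⨆ α : Fin K, ENNReal.ofReal ‖mean a - centroid a c α‖ / ENNReal.ofReal (avgWeight w c α)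

/-- `r = γ_max / γ_min`. -/
def ratio {n K d : ℕ} (a : Fin n → E d) (w : Fin n → Fin n → ℝ) (c : Fin n → Fin K) : ℝ≥0∞ :=
  gammaMax a w c / gammaMin a w c

/-- `r₂ = γ_max2 / γ_min`. -/
def ratio2 {n K d : ℕ} (a : Fin n → E d) (w : Fin n → Fin n → ℝ) (c : Fin n → Fin K) : ℝ≥0∞ :=
  gammaMax2 a w c / gammaMin a w c

/-- `(r² - 1) / (r² + 1)`, with its limit `1` for `r = ∞`. -/
def epsSup (r : ℝ≥0∞) : ℝ :=
  if r = ⊤ then 1 else (r.toReal ^ 2 - 1) / (r.toReal ^ 2 + 1)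

/-- `√(C p log n / d)`: for `ε` at least this number, `C p ε⁻² log n ≤ d`. -/
def epsMin (C p : ℝ) (n d : ℕ) : ℝ := Real.sqrt (C * p * Real.log n / d)

/-! ### The convex clustering model -/

/-- The objective of the weighted convex clustering model for the data `b`. -/
def objective {n m : ℕ} (b : Fin n → E m) (w : Fin n → Fin n → ℝ) (γ : ℝ≥0) (x : Fin n → E m) : ℝ :=
  1 / 2 * ∑ i, ‖x i - b i‖ ^ 2 + (γ : ℝ) * ∑ i, ∑ j ∈ Finset.Ioi i, w i j * ‖x i - x j‖

/-- `x` is an optimal solution of the model. -/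
def IsOptimal {n m : ℕ} (b : Fin n → E m) (w : Fin n → Fin n → ℝ) (γ : ℝ≥0) (x : Fin n → E m) :
    Prop :=
  ∀ y : Fin n → E m, objective b w γ x ≤ objective b w γ y

/-- `x i = x j` exactly when `i` and `j` are in the same block of the partition `c`. -/
def PerfectlyRecovers {n m L : ℕ} (x : Fin n → E m) (c : Fin n → Fin L) : Prop :=
  ∀ i j, x i = x j ↔ c i = c j

/-- `c'` is a coarsening, with at least two blocks, of the partition `c`: its blocks are the unions
of the clusters over the blocks of a partition of `Fin K` into `L > 1` non-empty parts. -/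
def IsNontrivialCoarsening {n K L : ℕ} (c : Fin n → Fin K) (c' : Fin n → Fin L) : Prop :=
  1 < L ∧ ∃ g : Fin K → Fin L, Function.Surjective g ∧ ∀ i, c' i = g (c i)

/-- `x` perfectly recovers some non-trivial coarsening of `c`. -/
def RecoversNontrivialCoarsening {n m K : ℕ} (x : Fin n → E m) (c : Fin n → Fin K) : Prop :=
  ∃ (L : ℕ) (c' : Fin n → Fin L), IsNontrivialCoarsening c c' ∧ PerfectlyRecovers x c'

/-- The model for the data `b` has exactly one optimal solution, and it satisfies `Q`. -/
def SolutionSatisfies {n m : ℕ} (b : Fin n → E m) (w : Fin n → Fin n → ℝ) (γ : ℝ≥0)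
    (Q : (Fin n → E m) → Prop) : Prop :=
  ∃ x, IsOptimal b w γ x ∧ (∀ y, IsOptimal b w γ y → y = x) ∧ Q x

/-! ### Random projections -/

/-- The Borel structure on real matrices: the product structure over the entries. -/
instance instMeasurableSpaceMatrix {m d : ℕ} : MeasurableSpace (Matrix (Fin m) (Fin d) ℝ) :=
  inferInstanceAs (MeasurableSpace (Fin m → Fin d → ℝ))

/-- The matrix `Π` applied to the vector `z`. -/
def proj {m d : ℕ} (P : Matrix (Fin m) (Fin d) ℝ) (z : E d) : E m :=
  WithLp.toLp 2 (P.mulVec z.ofLp)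

/-- A distributional Johnson-Lindenstrauss distribution over `m × d` matrices. -/
structure IsDJL {m d : ℕ} (ε δ : ℝ) (D : Measure (Matrix (Fin m) (Fin d) ℝ)) : Prop where
  isProbabilityMeasure : IsProbabilityMeasure D
  tail : ∀ z : E d, ‖z‖ = 1 → D {P | ε < |‖proj P z‖ ^ 2 - 1|} < ENNReal.ofReal δ

/-- The event that `Π` is an `ε`-isometry on all differences of points in the same cluster. -/
def withinClusterIsometry {n K d : ℕ} (m : ℕ) (a : Fin n → E d) (c : Fin n → Fin K) (ε : ℝ) :
    Set (Matrix (Fin m) (Fin d) ℝ) :=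
  {P | ∀ i j, c i = c j →
    (1 - ε) * ‖a i - a j‖ ^ 2 ≤ ‖proj P (a i - a j)‖ ^ 2 ∧
      ‖proj P (a i - a j)‖ ^ 2 ≤ (1 + ε) * ‖a i - a j‖ ^ 2}

end ConvexClustering

end

open ConvexClustering

/-!
Clustering the projected data `Π a` succeeds because the thresholds of the convex clustering model
involve only finitely many distances, and a Johnson-Lindenstrauss projection nearly preserves them.

*The model.* Let `b` be any data. If `‖b i - b j‖ ≤ γ (n_α w i j - μ i j)` inside every cluster, then
replacing a point `x` by its cluster means does not raise the objective, and lowers it unless `x` is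
constant on clusters. Indeed, linearize the penalty between different clusters at the cluster means:
what is left inside a cluster is a force `H i` with `‖H i - H j‖ ≤ ‖b i - b j‖ + γ μ i j`, and since
the deviations from the mean sum to zero, its work is an average of `⟪x i - x j, H i - H j⟫` over the
pairs of the cluster, which the attraction `γ w i j ‖x i - x j‖` dominates
(`cluster_term_nonneg`, `IsOptimal.eq_of_same_cluster`). So the optimal solution has one value `X_α`
for each cluster. Moving a single cluster gives `‖X_α - b^(α)‖ ≤ γ w̄^(α)`
(`IsOptimal.norm_sub_centroid_le`). Hence `X_α = X_β` forces
`‖b^(α) - b^(β)‖ ≤ γ (w̄^(α) + w̄^(β))`, which is excluded below `γ_max`; and if all the values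
coincide, they equal the mean of the data, which is excluded below `γ_max2`.

*Probability.* On the event `E₁` the lower threshold grows by at most the factor `√(1 + ε)`. The
upper thresholds shrink at most by the factor `√(1 - ε)` as soon as `Π` is an `ε`-isometry on the
differences of the centroids, respectively on one difference between the mean and a centroid. By the
union bound `P(E₁) ≥ 1 - (n² - n) / n ^ p`, and the second event fails with probability at most
`n / n ^ p`, because `K (K + 1) < n`; the conditional probability follows
(`one_sub_inv_le_cond`).

*Existence of the distributions.* For a matrix with independent `N(0, 1 / m)` entries and a unit
vector `z`, `m ‖Π z‖²` is chi-squared with `m` degrees of freedom, and Chernoff's bound gives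
`P(|‖Π z‖² - 1| > ε) ≤ 2 exp (-m ε² / 8)` (`gaussianMatrix_tail_le`).
-/

namespace ConvexClustering

/-! ### Gaussian matrices satisfy the distributional Johnson-Lindenstrauss property -/

/-- For `|x| ≤ 1 / 2` this is `-log (1 - x) ≤ x + x ^ 2`, the estimate that controls the moment
generating function of a chi-squared variable near `0`. -/
lemma exp_neg_add_sq_le_one_sub {x : ℝ} (h : |x| ≤ 1 / 2) : Real.exp (-(x + x ^ 2)) ≤ 1 - x := by
  obtain ⟨h1, h2⟩ := abs_le.1 h
  rw [Real.exp_neg]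
  refine inv_le_of_inv_le₀ (by linarith) ?_
  rw [inv_le_iff_one_le_mul₀ (by linarith)]
  rcases le_total 0 x with hx | hx
  · have hq := Real.quadratic_le_exp_of_nonneg (x := x + x ^ 2) (by positivity)
    have hm := mul_le_mul_of_nonneg_right hq (show 0 ≤ 1 - x by linarith)
    have hc : x ≤ (1 - x) * (1 + x) ^ 2 / 2 := by
      nlinarith [mul_nonneg hx (show 0 ≤ 1 / 2 - x by linarith),
        mul_nonneg (mul_nonneg hx hx) (show 0 ≤ 1 / 2 - x by linarith)]
    nlinarith [mul_le_mul_of_nonneg_left hc (sq_nonneg x)]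
  · have hq := Real.add_one_le_exp (x + x ^ 2)
    have hm := mul_le_mul_of_nonneg_right hq (show 0 ≤ 1 - x by linarith)
    nlinarith [mul_nonneg (neg_nonneg.2 hx) (sq_nonneg x)]

lemma gaussianPDFReal_smul_exp_mul_sq (t x : ℝ) :
    gaussianPDFReal 0 1 x • Real.exp (t * x ^ 2) =
      (√(2 * Real.pi))⁻¹ * Real.exp (-(1 / 2 - t) * x ^ 2) := by
  rw [gaussianPDFReal, smul_eq_mul, mul_assoc, ← Real.exp_add]
  congr 2
  · simp
  · simp; ring

lemma integrable_exp_mul_sq_gaussianReal {t : ℝ} (ht : t < 1 / 2) :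
    Integrable (fun x => Real.exp (t * x ^ 2)) (gaussianReal 0 1) := by
  rw [gaussianReal_of_var_ne_zero _ one_ne_zero, gaussianPDF_def,
    integrable_withDensity_iff_integrable_smul₀' (by fun_prop) (by simp)]
  refine ((integrable_exp_neg_mul_sq (b := 1 / 2 - t) (by linarith)).const_mul
    (√(2 * Real.pi))⁻¹).congr (.of_forall fun x => ?_)
  simp only [ENNReal.toReal_ofReal (gaussianPDFReal_nonneg 0 1 x)]
  exact (gaussianPDFReal_smul_exp_mul_sq t x).symm

lemma mgf_sq_gaussianReal {t : ℝ} (ht : t < 1 / 2) :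
    mgf (fun x => x ^ 2) (gaussianReal 0 1) t = (√(1 - 2 * t))⁻¹ := by
  rw [mgf, integral_gaussianReal_eq_integral_smul one_ne_zero]
  simp_rw [gaussianPDFReal_smul_exp_mul_sq]
  rw [integral_const_mul, integral_gaussian, ← Real.sqrt_inv, ← Real.sqrt_inv,
    ← Real.sqrt_mul (by positivity)]
  congr 1
  have : (1 : ℝ) - 2 * t ≠ 0 := by linarith
  have h2 : (1 : ℝ) / 2 - t ≠ 0 := by linarith
  field_simp

lemma mgf_sq_gaussianReal_le {t : ℝ} (ht : |t| ≤ 1 / 4) :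
    mgf (fun x => x ^ 2) (gaussianReal 0 1) t ≤ Real.exp (t + 2 * t ^ 2) := by
  have ht' := abs_le.1 ht
  rw [mgf_sq_gaussianReal (by linarith)]
  have h := exp_neg_add_sq_le_one_sub (x := 2 * t) (by rw [abs_mul, abs_two]; linarith)
  refine inv_le_of_inv_le₀ (Real.exp_pos _) ?_
  rw [← Real.exp_neg]
  refine Real.le_sqrt_of_sq_le ?_
  rw [← Real.exp_nat_mul]
  refine le_trans (le_of_eq ?_) h
  congr 1
  push_cast
  ring

lemma stdGaussian_map_inner {d : ℕ} {z : E d} (hz : ‖z‖ = 1) :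
    (stdGaussian (E d)).map (fun x => inner ℝ z x) = gaussianReal 0 1 := by
  have h := IsGaussian.map_eq_gaussianReal (μ := stdGaussian (E d)) (innerSL ℝ z)
  rw [integral_strongDual_stdGaussian, variance_dual_stdGaussian, innerSL_apply_norm, hz] at h
  simpa using h

/-- The matrix with rows `g i / √m`. -/
noncomputable def scaledRows {m d : ℕ} (g : Fin m → E d) : Matrix (Fin m) (Fin d) ℝ :=
  fun i j => (√m)⁻¹ * g i j

lemma measurable_scaledRows (m d : ℕ) : Measurable (scaledRows : (Fin m → E d) → _) := by
  change Measurable fun (g : Fin m → E d) => ((fun i j => (√m)⁻¹ * g i j : Fin m → Fin d → ℝ))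
  fun_prop

/-- The law of an `m × d` matrix with independent `N(0, 1 / m)` entries, described by its rows. -/
noncomputable def gaussianMatrix (m d : ℕ) : Measure (Matrix (Fin m) (Fin d) ℝ) :=
  (Measure.pi fun _ : Fin m => stdGaussian (E d)).map scaledRows

lemma measurable_proj {m d : ℕ} (z : E d) :
    Measurable fun P : Matrix (Fin m) (Fin d) ℝ => proj P z := by
  refine (PiLp.continuous_toLp 2 _).measurable.comp (measurable_pi_lambda _ fun i => ?_)
  simp only [Matrix.mulVec, dotProduct]
  refine Finset.measurable_sum _ fun j _ => Measurable.mul_const ?_ _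
  exact (measurable_pi_apply j).comp
    (measurable_pi_apply (X := fun _ : Fin m => Fin d → ℝ) i)

instance isProbabilityMeasure_gaussianMatrix (m d : ℕ) :
    IsProbabilityMeasure (gaussianMatrix m d) :=
  Measure.isProbabilityMeasure_map (measurable_scaledRows m d).aemeasurable

lemma norm_sq_proj_scaledRows {m d : ℕ} (g : Fin m → E d) (z : E d) :
    ‖proj (scaledRows g) z‖ ^ 2 = (m : ℝ)⁻¹ * ∑ i, (inner ℝ z (g i)) ^ 2 := by
  rw [EuclideanSpace.real_norm_sq_eq, Finset.mul_sum]
  refine Finset.sum_congr rfl fun i _ => ?_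
  have : (proj (scaledRows g) z) i = (√m)⁻¹ * inner ℝ z (g i) := by
    simp only [proj, scaledRows, Matrix.mulVec, dotProduct, PiLp.inner_apply, Finset.mul_sum]
    refine Finset.sum_congr rfl fun j _ => ?_
    simp [mul_assoc]
  rw [this, mul_pow, inv_pow, Real.sq_sqrt (Nat.cast_nonneg m)]

/-- The squared norm of `z` under a standard Gaussian matrix is chi-squared with `m` degrees of
freedom. -/
lemma mgf_sum_inner_sq {m d : ℕ} {z : E d} (hz : ‖z‖ = 1) {t : ℝ} (ht : |t| ≤ 1 / 4) :
    Integrable (fun g : Fin m → E d => Real.exp (t * ∑ i, (inner ℝ z (g i)) ^ 2))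
        (Measure.pi fun _ => stdGaussian (E d)) ∧
      mgf (fun g : Fin m → E d => ∑ i, (inner ℝ z (g i)) ^ 2)
        (Measure.pi fun _ => stdGaussian (E d)) t ≤ Real.exp (m * (t + 2 * t ^ 2)) := by
  have ht' := abs_le.1 ht
  have hmeas : Measurable fun x : E d => (inner ℝ z x : ℝ) ^ 2 := by fun_prop
  have hind : iIndepFun (fun (i : Fin m) (g : Fin m → E d) => (inner ℝ z (g i) : ℝ) ^ 2)
      (Measure.pi fun _ => stdGaussian (E d)) :=
    iIndepFun_pi (X := fun _ x => (inner ℝ z x : ℝ) ^ 2) fun _ => hmeas.aemeasurable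
  have hm : ∀ i : Fin m, Measurable fun g : Fin m → E d => (inner ℝ z (g i) : ℝ) ^ 2 :=
    fun i => hmeas.comp (measurable_pi_apply i)
  have hmap : ∀ i : Fin m, (Measure.pi fun _ : Fin m => stdGaussian (E d)).map
      (fun g => (inner ℝ z (g i) : ℝ)) = gaussianReal 0 1 := by
    intro i
    have h := Measure.map_map (μ := Measure.pi fun _ : Fin m => stdGaussian (E d))
      (g := fun x => (inner ℝ z x : ℝ)) (f := Function.eval i) (by fun_prop) (by fun_prop)
    rw [(measurePreserving_eval (fun _ : Fin m => stdGaussian (E d)) i).map_eq,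
      stdGaussian_map_inner hz] at h
    exact h.symm
  have hmi : ∀ i : Fin m, Measurable fun g : Fin m → E d => (inner ℝ z (g i) : ℝ) := by fun_prop
  have hint : ∀ i : Fin m, Integrable (fun g : Fin m → E d =>
      Real.exp (t * (inner ℝ z (g i) : ℝ) ^ 2)) (Measure.pi fun _ => stdGaussian (E d)) := by
    intro i
    have h := integrable_exp_mul_sq_gaussianReal (t := t) (by linarith)
    rw [← hmap i] at h
    exact h.comp_measurable (hmi i)
  have hfun : (fun g : Fin m → E d => ∑ i, (inner ℝ z (g i) : ℝ) ^ 2) =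
      ∑ i : Fin m, fun g : Fin m → E d => (inner ℝ z (g i) : ℝ) ^ 2 := by
    ext g; simp
  constructor
  · have := hind.integrable_exp_mul_sum hm (s := Finset.univ) (t := t) fun i _ => hint i
    simpa using this
  · rw [hfun, hind.mgf_sum hm]
    calc ∏ i : Fin m, mgf (fun g : Fin m → E d => (inner ℝ z (g i) : ℝ) ^ 2)
          (Measure.pi fun _ => stdGaussian (E d)) t
        ≤ ∏ _i : Fin m, Real.exp (t + 2 * t ^ 2) := by
          refine Finset.prod_le_prod (fun i _ => mgf_nonneg) fun i _ => ?_
          refine le_trans (le_of_eq ?_) (mgf_sq_gaussianReal_le ht)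
          rw [← hmap i, mgf, mgf, integral_map (hmi i).aemeasurable (by fun_prop)]
      _ = Real.exp (m * (t + 2 * t ^ 2)) := by
          rw [Finset.prod_const, Finset.card_univ, Fintype.card_fin, ← Real.exp_nat_mul]

/-- Chernoff's bound with the parameters `ε / 4` and `-ε / 4` for the two tails. -/
lemma gaussianMatrix_tail_le {m d : ℕ} (hm : 1 ≤ m) {ε : ℝ} (h0 : 0 < ε) (h1 : ε < 1) {z : E d}
    (hz : ‖z‖ = 1) :
    (gaussianMatrix m d).real {P | ε < |‖proj P z‖ ^ 2 - 1|} ≤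
      2 * Real.exp (-(m * ε ^ 2 / 8)) := by
  have hm0 : (0 : ℝ) < m := by exact_mod_cast hm
  have hS : MeasurableSet {P : Matrix (Fin m) (Fin d) ℝ | ε < |‖proj P z‖ ^ 2 - 1|} := by
    have := measurable_proj (m := m) z
    exact measurableSet_lt measurable_const
      (continuous_abs.measurable.comp ((this.norm.pow_const 2).sub_const 1))
  rw [measureReal_def, gaussianMatrix, Measure.map_apply (measurable_scaledRows m d) hS,
    ← measureReal_def]
  set ν : Measure (Fin m → E d) := Measure.pi fun _ => stdGaussian (E d)
  set Q : (Fin m → E d) → ℝ := fun g => ∑ i, (inner ℝ z (g i)) ^ 2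
  have hsub : scaledRows ⁻¹' {P : Matrix (Fin m) (Fin d) ℝ | ε < |‖proj P z‖ ^ 2 - 1|} ⊆
      {g | m * (1 + ε) ≤ Q g} ∪ {g | Q g ≤ m * (1 - ε)} := by
    intro g hg
    have hg' : ε < |(m : ℝ)⁻¹ * Q g - 1| := by
      have h := norm_sq_proj_scaledRows g z
      change ε < |‖proj (scaledRows g) z‖ ^ 2 - 1| at hg
      rwa [h] at hg
    have hQ : (m : ℝ) * ((m : ℝ)⁻¹ * Q g) = Q g := by field_simp
    rcases lt_abs.1 hg' with h | h
    · left
      change m * (1 + ε) ≤ Q g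
      rw [← hQ]
      exact mul_le_mul_of_nonneg_left (by linarith) hm0.le
    · right
      change Q g ≤ m * (1 - ε)
      rw [← hQ]
      exact mul_le_mul_of_nonneg_left (by linarith) hm0.le
  obtain ⟨i1, b1⟩ := mgf_sum_inner_sq (m := m) hz (t := ε / 4)
    (by rw [abs_of_pos (by linarith)]; linarith)
  obtain ⟨i2, b2⟩ := mgf_sum_inner_sq (m := m) hz (t := -(ε / 4))
    (by rw [abs_neg, abs_of_pos (by linarith)]; linarith)
  have u1 : ν.real {g | m * (1 + ε) ≤ Q g} ≤ Real.exp (-(m * ε ^ 2 / 8)) := by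
    refine (measure_ge_le_exp_mul_mgf _ (by linarith : 0 ≤ ε / 4) i1).trans
      ((mul_le_mul_of_nonneg_left b1 (Real.exp_pos _).le).trans (le_of_eq ?_))
    rw [← Real.exp_add]
    congr 1
    ring
  have u2 : ν.real {g | Q g ≤ m * (1 - ε)} ≤ Real.exp (-(m * ε ^ 2 / 8)) := by
    refine (measure_le_le_exp_mul_mgf _ (by linarith : -(ε / 4) ≤ 0) i2).trans
      ((mul_le_mul_of_nonneg_left b2 (Real.exp_pos _).le).trans (le_of_eq ?_))
    rw [← Real.exp_add]
    congr 1
    ring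
  calc _ ≤ ν.real ({g | m * (1 + ε) ≤ Q g} ∪ {g | Q g ≤ m * (1 - ε)}) := measureReal_mono hsub
    _ ≤ _ := measureReal_union_le _ _
    _ ≤ _ := by linarith

/-- With `m = ⌊C p log n / ε²⌋` rows the Gaussian matrix has `m ≥ C p log n / (2 ε²)`, and `C ≥ 32`
makes its tail smaller than `2 / n ^ p`. -/
lemma exists_isDJL {C p : ℝ} (hC : 32 ≤ C) (hp : 2 < p) {n : ℕ} (hn : 3 ≤ n) (d : ℕ) {ε : ℝ}
    (h0 : 0 < ε) (h1 : ε < 1) :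
    ∃ m : ℕ, 1 ≤ m ∧ (m : ℝ) ≤ C * p * Real.log n / ε ^ 2 ∧
      ∃ D : Measure (Matrix (Fin m) (Fin d) ℝ), IsDJL ε (2 / (n : ℝ) ^ p) D := by
  have hn0 : (0 : ℝ) < n := by positivity
  have hlog : 1 < Real.log n := by
    rw [Real.lt_log_iff_exp_lt hn0]
    have : (3 : ℝ) ≤ n := by exact_mod_cast hn
    linarith [Real.exp_one_lt_three]
  have hpl : 2 < p * Real.log n := by nlinarith
  set x := C * p * Real.log n / ε ^ 2 with hx
  have hxe : x * ε ^ 2 = C * (p * Real.log n) := by rw [hx]; field_simp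
  have hCp : 32 * (p * Real.log n) ≤ C * (p * Real.log n) :=
    mul_le_mul_of_nonneg_right hC (by linarith)
  have he2 : ε ^ 2 < 1 := by nlinarith
  have hx2 : 2 ≤ x := by
    by_contra! h
    nlinarith [sq_nonneg ε, mul_pos h0 h0]
  have hfl := Nat.lt_floor_add_one x
  refine ⟨⌊x⌋₊, Nat.le_floor (by norm_num; linarith), Nat.floor_le (by linarith),
    gaussianMatrix _ d, inferInstance, fun z hz => ?_⟩
  have hm : 1 ≤ ⌊x⌋₊ := Nat.le_floor (by norm_num; linarith)
  rw [← ofReal_measureReal]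
  refine (ENNReal.ofReal_lt_ofReal_iff (by positivity)).2
    ((gaussianMatrix_tail_le hm h0 h1 hz).trans_lt ?_)
  rw [div_eq_mul_inv (2 : ℝ), ← Real.rpow_neg hn0.le, Real.rpow_def_of_pos hn0]
  refine mul_lt_mul_of_pos_left (Real.exp_lt_exp.2 ?_) two_pos
  have hmx : x / 2 ≤ (⌊x⌋₊ : ℝ) := by linarith
  have := mul_le_mul_of_nonneg_right hmx (sq_nonneg ε)
  linarith

/-! ### The convex clustering objective -/

lemma sum_sum_eq_two_mul_sum_Ioi {n : ℕ} (f : Fin n → Fin n → ℝ) (hs : ∀ i j, f i j = f j i)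
    (h0 : ∀ i, f i i = 0) : ∑ i, ∑ j, f i j = 2 * ∑ i, ∑ j ∈ Finset.Ioi i, f i j := by
  have hI : ∀ i, ∑ j ∈ Finset.Ioi i, f i j = ∑ j, if i < j then f i j else 0 := fun i => by
    rw [← Finset.sum_filter]
    congr 1
    ext j
    simp
  have hsplit : ∀ i j, f i j = (if i < j then f i j else 0) + (if j < i then f j i else 0) := by
    intro i j
    rcases lt_trichotomy i j with h | h | h
    · simp [h, h.not_gt]
    · simp [h, h0]
    · simp [h, h.not_gt, hs i j]
  simp_rw [hI]
  calc ∑ i, ∑ j, f i j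
      = ∑ i, ∑ j, ((if i < j then f i j else 0) + (if j < i then f j i else 0)) :=
        Finset.sum_congr rfl fun i _ => Finset.sum_congr rfl fun j _ => hsplit i j
    _ = _ := by
        simp_rw [Finset.sum_add_distrib]
        rw [Finset.sum_comm (f := fun i j => if j < i then f j i else 0)]
        ring

lemma weight_mul_norm_sub_symm {n m : ℕ} {w : Fin n → Fin n → ℝ}
    (hs : ∀ i j, i ≠ j → w i j = w j i) (x : Fin n → E m) (i j : Fin n) :
    w i j * ‖x i - x j‖ = w j i * ‖x j - x i‖ := by
  rcases eq_or_ne i j with rfl | h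
  · rfl
  · rw [hs i j h, norm_sub_rev]

lemma objective_eq_sum_sum {n m : ℕ} (b : Fin n → E m) {w : Fin n → Fin n → ℝ}
    (hs : ∀ i j, i ≠ j → w i j = w j i) (γ : ℝ≥0) (x : Fin n → E m) :
    objective b w γ x =
      1 / 2 * ∑ i, ‖x i - b i‖ ^ 2 + (γ : ℝ) / 2 * ∑ i, ∑ j, w i j * ‖x i - x j‖ := by
  rw [objective, sum_sum_eq_two_mul_sum_Ioi _ (weight_mul_norm_sub_symm hs x) (by simp)]
  ring

lemma penalty_nonneg {n m : ℕ} {w : Fin n → Fin n → ℝ} (hw : ∀ i j, i ≠ j → 0 ≤ w i j)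
    (x : Fin n → E m) (i j : Fin n) : 0 ≤ w i j * ‖x i - x j‖ := by
  rcases eq_or_ne i j with rfl | h
  · simp
  · exact mul_nonneg (hw i j h) (norm_nonneg _)

lemma exists_isOptimal {n m : ℕ} (b : Fin n → E m) {w : Fin n → Fin n → ℝ}
    (hw : ∀ i j, i ≠ j → 0 ≤ w i j) (γ : ℝ≥0) : ∃ x, IsOptimal b w γ x := by
  have hcont : Continuous (objective b w γ) := by unfold objective; fun_prop
  have hlow : ∀ x i, 1 / 2 * ‖x i - b i‖ ^ 2 ≤ objective b w γ x := by
    intro x i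
    have h1 : ‖x i - b i‖ ^ 2 ≤ ∑ i, ‖x i - b i‖ ^ 2 :=
      Finset.single_le_sum (f := fun i => ‖x i - b i‖ ^ 2) (fun _ _ => by positivity)
        (Finset.mem_univ i)
    have h2 : 0 ≤ (γ : ℝ) * ∑ i, ∑ j ∈ Finset.Ioi i, w i j * ‖x i - x j‖ :=
      mul_nonneg γ.2 (Finset.sum_nonneg fun i _ => Finset.sum_nonneg fun j _ =>
        penalty_nonneg hw x i j)
    unfold objective
    linarith
  set M := objective b w γ b
  have hM : 0 ≤ |M| := abs_nonneg M
  refine hcont.exists_forall_le' b ?_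
  filter_upwards [(isCompact_closedBall b (2 * |M| + 1)).compl_mem_cocompact] with x hx
  by_contra! hlt
  refine hx ?_
  rw [Metric.mem_closedBall, dist_eq_norm, pi_norm_le_iff_of_nonneg (by positivity)]
  intro i
  by_contra! hi
  have h3 := hlow x i
  have h4 : M ≤ |M| := le_abs_self M
  rw [Pi.sub_apply] at hi
  nlinarith

/-- Strict convexity: by the parallelogram identity the midpoint of two distinct points with equal
values has a smaller value. -/
lemma IsOptimal.unique {n m : ℕ} {b : Fin n → E m} {w : Fin n → Fin n → ℝ}
    (hw : ∀ i j, i ≠ j → 0 ≤ w i j) {γ : ℝ≥0} {x y : Fin n → E m}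
    (hx : IsOptimal b w γ x) (hy : IsOptimal b w γ y) : y = x := by
  set z : Fin n → E m := fun i => (1 / 2 : ℝ) • (x i + y i) with hz
  have hfid : ∀ i, ‖z i - b i‖ ^ 2 =
      1 / 2 * ‖x i - b i‖ ^ 2 + 1 / 2 * ‖y i - b i‖ ^ 2 - 1 / 4 * ‖y i - x i‖ ^ 2 := by
    intro i
    have h1 : z i - b i = (1 / 2 : ℝ) • ((x i - b i) + (y i - b i)) := by
      simp only [hz]; module
    have h3 := parallelogram_law_with_norm ℝ (y i - b i) (x i - b i)
    rw [sub_sub_sub_cancel_right] at h3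
    rw [h1, norm_smul, add_comm (x i - b i), mul_pow]
    norm_num
    linarith
  have hpen : ∀ i j, w i j * ‖z i - z j‖ ≤
      1 / 2 * (w i j * ‖x i - x j‖) + 1 / 2 * (w i j * ‖y i - y j‖) := by
    intro i j
    rcases eq_or_ne i j with rfl | h
    · simp
    have h1 : z i - z j = (1 / 2 : ℝ) • ((x i - x j) + (y i - y j)) := by
      simp only [hz]; module
    have h2 : ‖z i - z j‖ ≤ 1 / 2 * (‖x i - x j‖ + ‖y i - y j‖) := by
      rw [h1, norm_smul]
      norm_num
      exact norm_add_le _ _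
    have := mul_le_mul_of_nonneg_left h2 (hw i j h)
    linarith
  have hP : ∑ i, ∑ j ∈ Finset.Ioi i, w i j * ‖z i - z j‖ ≤
      1 / 2 * (∑ i, ∑ j ∈ Finset.Ioi i, w i j * ‖x i - x j‖) +
        1 / 2 * ∑ i, ∑ j ∈ Finset.Ioi i, w i j * ‖y i - y j‖ := by
    simp_rw [Finset.mul_sum, ← Finset.sum_add_distrib]
    exact Finset.sum_le_sum fun i _ => Finset.sum_le_sum fun j _ => hpen i j
  have hF : ∑ i, ‖z i - b i‖ ^ 2 = 1 / 2 * ∑ i, ‖x i - b i‖ ^ 2 +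
      1 / 2 * ∑ i, ‖y i - b i‖ ^ 2 - 1 / 4 * ∑ i, ‖y i - x i‖ ^ 2 := by
    simp_rw [hfid, Finset.mul_sum, Finset.sum_sub_distrib, Finset.sum_add_distrib]
  have hxy := hx y
  have hyx := hy x
  have hxz := hx z
  have hPγ := mul_le_mul_of_nonneg_left hP γ.2
  have hsum : ∑ i, ‖y i - x i‖ ^ 2 ≤ 0 := by
    unfold objective at hxy hyx hxz
    simp only [NNReal.val_eq_coe] at hPγ
    linarith
  have h0 := (Finset.sum_eq_zero_iff_of_nonneg (fun i _ => sq_nonneg ‖y i - x i‖)).1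
    (le_antisymm hsum (Finset.sum_nonneg fun i _ => sq_nonneg _))
  funext i
  have := h0 i (Finset.mem_univ i)
  rw [sq_eq_zero_iff, norm_eq_zero, sub_eq_zero] at this
  exact this

/-- The first-order optimality condition: no direction `v` is a descent direction. The derivative of
the penalty along `v` is only bounded above, by the triangle inequality. -/
lemma IsOptimal.first_order {n m : ℕ} {b : Fin n → E m} {w : Fin n → Fin n → ℝ}
    (hs : ∀ i j, i ≠ j → w i j = w j i) (hw : ∀ i j, i ≠ j → 0 ≤ w i j) {γ : ℝ≥0}
    {x : Fin n → E m} (hx : IsOptimal b w γ x) (v : Fin n → E m) :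
    0 ≤ ∑ i, inner ℝ (v i) (x i - b i) + (γ : ℝ) / 2 * ∑ i, ∑ j, w i j * ‖v i - v j‖ := by
  set A := ∑ i, inner ℝ (v i) (x i - b i) + (γ : ℝ) / 2 * ∑ i, ∑ j, w i j * ‖v i - v j‖ with hA
  set B := ∑ i, ‖v i‖ ^ 2 with hB
  have hB0 : 0 ≤ B := Finset.sum_nonneg fun i _ => sq_nonneg _
  have key : ∀ t : ℝ, 0 < t → 0 ≤ t * A + t ^ 2 / 2 * B := by
    intro t ht
    have h := hx fun i => x i + t • v i
    rw [objective_eq_sum_sum b hs, objective_eq_sum_sum b hs] at h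
    have hf : ∑ i, ‖x i + t • v i - b i‖ ^ 2 = ∑ i, ‖x i - b i‖ ^ 2 +
        2 * t * ∑ i, inner ℝ (v i) (x i - b i) + t ^ 2 * B := by
      simp_rw [hB, Finset.mul_sum, ← Finset.sum_add_distrib]
      refine Finset.sum_congr rfl fun i _ => ?_
      rw [show x i + t • v i - b i = (x i - b i) + t • v i by abel, norm_add_sq_real,
        inner_smul_right, norm_smul, mul_pow, Real.norm_eq_abs, sq_abs, real_inner_comm]
      ring
    have hp : ∑ i, ∑ j, w i j * ‖x i + t • v i - (x j + t • v j)‖ ≤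
        ∑ i, ∑ j, w i j * ‖x i - x j‖ + t * ∑ i, ∑ j, w i j * ‖v i - v j‖ := by
      simp_rw [Finset.mul_sum, ← Finset.sum_add_distrib]
      refine Finset.sum_le_sum fun i _ => Finset.sum_le_sum fun j _ => ?_
      rcases eq_or_ne i j with rfl | hij
      · simp
      have : ‖x i + t • v i - (x j + t • v j)‖ ≤ ‖x i - x j‖ + t * ‖v i - v j‖ := by
        rw [show x i + t • v i - (x j + t • v j) = (x i - x j) + t • (v i - v j) by module]
        refine (norm_add_le _ _).trans_eq ?_
        rw [norm_smul, Real.norm_eq_abs, abs_of_pos ht]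
      have := mul_le_mul_of_nonneg_left this (hw i j hij)
      linarith
    have hp' := mul_le_mul_of_nonneg_left hp (show 0 ≤ (γ : ℝ) / 2 from by positivity)
    rw [hf] at h
    rw [hA]
    linarith
  by_contra! hneg
  have h := key (-A / (B + 1)) (div_pos (by linarith) (by linarith))
  have h2 : -A / (B + 1) * A + (-A / (B + 1)) ^ 2 / 2 * B =
      (A / (B + 1)) ^ 2 * (-(B + 1) + B / 2) := by
    field_simp
  rw [h2] at h
  have h3 : 0 < (A / (B + 1)) ^ 2 := by
    have : A / (B + 1) ≠ 0 := (div_neg_of_neg_of_pos hneg (by linarith)).ne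
    positivity
  nlinarith

/-! ### The optimal solution is constant on clusters -/

lemma mem_idx {n K : ℕ} {c : Fin n → Fin K} {α : Fin K} {i : Fin n} : i ∈ idx c α ↔ c i = α := by
  simp [idx]

lemma sum_eq_sum_idx {n K : ℕ} {M : Type*} [AddCommMonoid M] (c : Fin n → Fin K) (f : Fin n → M) :
    ∑ i, f i = ∑ α, ∑ i ∈ idx c α, f i :=
  (Finset.sum_fiberwise Finset.univ c f).symm

lemma sum_idx_sub_centroid {n K m : ℕ} (x : Fin n → E m) (c : Fin n → Fin K) (α : Fin K) :
    ∑ i ∈ idx c α, (x i - centroid x c α) = 0 := by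
  rw [Finset.sum_sub_distrib, Finset.sum_const, centroid, ← Nat.cast_smul_eq_nsmul ℝ, smul_smul]
  rcases Nat.eq_zero_or_pos (idx c α).card with h | h
  · simp [Finset.card_eq_zero.1 h]
  · rw [size, mul_inv_cancel₀ (by positivity), one_smul, sub_self]

lemma sum_sum_inner_sub_sub {ι : Type*} {m : ℕ} (S : Finset ι) {p : ι → E m} (q : ι → E m)
    (hp : ∑ i ∈ S, p i = 0) :
    ∑ i ∈ S, ∑ j ∈ S, inner ℝ (p i - p j) (q i - q j) =
      2 * (S.card : ℝ) * ∑ i ∈ S, inner ℝ (p i) (q i) := by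
  have h1 : ∑ i ∈ S, ∑ j ∈ S, inner ℝ (p i) (q j) = (0 : ℝ) := by
    rw [Finset.sum_comm]
    simp_rw [← sum_inner, hp, inner_zero_left, Finset.sum_const_zero]
  have h2 : ∑ i ∈ S, ∑ j ∈ S, inner ℝ (p j) (q i) = (0 : ℝ) := by
    simp_rw [← sum_inner, hp, inner_zero_left, Finset.sum_const_zero]
  simp_rw [inner_sub_left, inner_sub_right, Finset.sum_sub_distrib, h1, h2, Finset.sum_const,
    nsmul_eq_mul, ← Finset.mul_sum]
  ring

/-- The unit vector from `q` towards `p`, and `0` if `p = q`: a subgradient of the norm at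
`p - q`. -/
noncomputable def direction {m : ℕ} (p q : E m) : E m := ‖p - q‖⁻¹ • (p - q)

lemma direction_self {m : ℕ} (p : E m) : direction p p = 0 := by simp [direction]

lemma direction_swap {m : ℕ} (p q : E m) : direction q p = -direction p q := by
  rw [direction, direction, norm_sub_rev, ← smul_neg, neg_sub]

lemma norm_direction_le {m : ℕ} (p q : E m) : ‖direction p q‖ ≤ 1 := by
  rw [direction, norm_smul, norm_inv, norm_norm]
  exact inv_mul_le_one

lemma inner_direction {m : ℕ} (p q : E m) : inner ℝ (p - q) (direction p q) = ‖p - q‖ := by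
  rcases eq_or_ne p q with rfl | h
  · simp [direction]
  · have : ‖p - q‖ ≠ 0 := norm_ne_zero_iff.2 (sub_ne_zero.2 h)
    rw [direction, inner_smul_right, real_inner_self_eq_norm_sq]
    field_simp

/-- The subgradient of the penalty between clusters at a point with the cluster values `X`, seen
from the data point `i`. -/
noncomputable def pull {n K m : ℕ} (w : Fin n → Fin n → ℝ) (c : Fin n → Fin K) (X : Fin K → E m)
    (i : Fin n) : E m :=
  ∑ β, pointWeight w c i β • direction (X (c i)) (X β)

lemma pull_eq_sum {n K m : ℕ} (w : Fin n → Fin n → ℝ) (c : Fin n → Fin K) (X : Fin K → E m)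
    (i : Fin n) : pull w c X i = ∑ j, w i j • direction (X (c i)) (X (c j)) := by
  rw [pull, sum_eq_sum_idx c]
  refine Finset.sum_congr rfl fun β _ => ?_
  rw [pointWeight, Finset.sum_smul]
  exact Finset.sum_congr rfl fun j hj => by rw [mem_idx.1 hj]

lemma norm_pull_sub_le {n K m : ℕ} (w : Fin n → Fin n → ℝ) (c : Fin n → Fin K) (X : Fin K → E m)
    {i j : Fin n} (h : c i = c j) : ‖pull w c X i - pull w c X j‖ ≤ weightGap w c (c i) i j := by
  rw [pull, pull, ← Finset.sum_sub_distrib, weightGap, Finset.sum_filter]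
  refine (norm_sum_le _ _).trans (Finset.sum_le_sum fun β _ => ?_)
  rw [← h, ← sub_smul, norm_smul, Real.norm_eq_abs]
  split_ifs with hβ
  · exact mul_le_of_le_one_right (abs_nonneg _) (norm_direction_le _ _)
  · rw [not_not.1 hβ, direction_self, norm_zero, mul_zero]

/-- Antisymmetry of `direction` collects the pairwise terms into one term for each data point. -/
lemma sum_sum_mul_inner_direction {n K m : ℕ} {w : Fin n → Fin n → ℝ}
    (hs : ∀ i j, i ≠ j → w i j = w j i) (c : Fin n → Fin K) (X : Fin K → E m) (y : Fin n → E m) :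
    ∑ i, ∑ j, w i j * inner ℝ (y i - y j) (direction (X (c i)) (X (c j))) =
      2 * ∑ i, inner ℝ (y i) (pull w c X i) := by
  have h1 : ∀ i j, w i j * inner ℝ (y i - y j) (direction (X (c i)) (X (c j))) =
      w i j * inner ℝ (y i) (direction (X (c i)) (X (c j))) +
        w j i * inner ℝ (y j) (direction (X (c j)) (X (c i))) := by
    intro i j
    rcases eq_or_ne i j with rfl | h
    · simp [direction_self]
    · rw [hs j i h.symm, direction_swap (X (c i)) (X (c j)), inner_neg_right, inner_sub_left]
      ring
  simp_rw [h1, Finset.sum_add_distrib]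
  rw [Finset.sum_comm (f := fun i j => w j i * inner ℝ (y j) (direction (X (c j)) (X (c i)))),
    ← two_mul]
  simp_rw [pull_eq_sum, inner_sum, inner_smul_right]

/-- The pairwise attraction inside a cluster dominates every force `H` that varies by at most
`γ n_α w i j` inside the cluster. -/
lemma cluster_term_nonneg {ι : Type*} {m : ℕ} (S : Finset ι) {w : ι → ι → ℝ} {γ : ℝ}
    {y H : ι → E m} (hy : ∑ i ∈ S, y i = 0)
    (hH : ∀ i ∈ S, ∀ j ∈ S, i ≠ j → ‖H i - H j‖ ≤ γ * (S.card * w i j)) :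
    0 ≤ ∑ i ∈ S, inner ℝ (y i) (H i) + γ / 2 * ∑ i ∈ S, ∑ j ∈ S, w i j * ‖y i - y j‖ := by
  rcases S.eq_empty_or_nonempty with rfl | hS
  · simp
  have hN : (0 : ℝ) < S.card := by exact_mod_cast hS.card_pos
  have h1 : -(γ * S.card * ∑ i ∈ S, ∑ j ∈ S, w i j * ‖y i - y j‖) ≤
      ∑ i ∈ S, ∑ j ∈ S, inner ℝ (y i - y j) (H i - H j) := by
    simp_rw [Finset.mul_sum, ← Finset.sum_neg_distrib]
    refine Finset.sum_le_sum fun i hi => Finset.sum_le_sum fun j hj => ?_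
    rcases eq_or_ne i j with rfl | hij
    · simp
    have h2 := neg_le_of_abs_le (abs_real_inner_le_norm (y i - y j) (H i - H j))
    have h3 := mul_le_mul_of_nonneg_left (hH i hi j hj hij) (norm_nonneg (y i - y j))
    linarith
  rw [sum_sum_inner_sub_sub S H hy] at h1
  refine nonneg_of_mul_nonneg_right (a := 2 * (S.card : ℝ)) ?_ (by positivity)
  linarith

/-- Replacing `x` by its cluster means lowers the objective, strictly unless `x` is constant on
clusters: linearizing the penalty between clusters at the means leaves, inside each cluster, a force
which the attraction inside the cluster dominates. -/
theorem IsOptimal.eq_of_same_cluster {n K m : ℕ} {b : Fin n → E m} {w : Fin n → Fin n → ℝ}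
    {c : Fin n → Fin K} (hs : ∀ i j, i ≠ j → w i j = w j i) (hw : ∀ i j, i ≠ j → 0 ≤ w i j)
    {γ : ℝ≥0} {x : Fin n → E m} (hx : IsOptimal b w γ x)
    (hγ : ∀ i j, c i = c j → i ≠ j →
      ‖b i - b j‖ ≤ γ * ((size c (c i) : ℝ) * w i j - weightGap w c (c i) i j))
    {i j : Fin n} (hij : c i = c j) : x i = x j := by
  set X : Fin K → E m := centroid x c with hX
  set y : Fin n → E m := fun i => x i - X (c i) with hy
  have hy0 : ∀ α, ∑ i ∈ idx c α, y i = 0 := fun α => by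
    rw [← sum_idx_sub_centroid x c α]
    exact Finset.sum_congr rfl fun i hi => by rw [hy, hX, ← mem_idx.1 hi]
  set H : Fin n → E m := fun i => X (c i) - b i + (γ : ℝ) • pull w c X i with hH
  have hyy : ∀ i j, c i = c j → y i - y j = x i - x j := fun i j h => by simp [hy, h]
  have hpen : ∀ i j, w i j * inner ℝ (y i - y j) (direction (X (c i)) (X (c j))) +
      (if c i = c j then w i j * ‖y i - y j‖ else 0) ≤
        w i j * ‖x i - x j‖ - w i j * ‖X (c i) - X (c j)‖ := by
    intro i j
    split_ifs with h
    · rw [hyy i j h, h, direction_self]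
      simp
    · have hne : i ≠ j := fun e => h (by rw [e])
      have h1 := real_inner_le_norm (x i - x j) (direction (X (c i)) (X (c j)))
      have h2 : ‖x i - x j‖ * ‖direction (X (c i)) (X (c j))‖ ≤ ‖x i - x j‖ :=
        mul_le_of_le_one_right (norm_nonneg _) (norm_direction_le _ _)
      have h3 : y i - y j = (x i - x j) - (X (c i) - X (c j)) := by simp only [hy]; abel
      rw [h3, inner_sub_left, inner_direction, add_zero, ← mul_sub]
      exact mul_le_mul_of_nonneg_left (by linarith) (hw i j hne)
  have hsum := Finset.sum_le_sum fun i (_ : i ∈ Finset.univ) =>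
    Finset.sum_le_sum fun j (_ : j ∈ Finset.univ) => hpen i j
  simp_rw [Finset.sum_add_distrib, Finset.sum_sub_distrib] at hsum
  rw [sum_sum_mul_inner_direction hs] at hsum
  have hsum' := mul_le_mul_of_nonneg_left hsum (show 0 ≤ (γ : ℝ) / 2 by positivity)
  have hfid : ∑ i, ‖x i - b i‖ ^ 2 = ∑ i, ‖y i‖ ^ 2 + 2 * ∑ i, inner ℝ (y i) (X (c i) - b i) +
      ∑ i, ‖X (c i) - b i‖ ^ 2 := by
    rw [Finset.mul_sum, ← Finset.sum_add_distrib, ← Finset.sum_add_distrib]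
    refine Finset.sum_congr rfl fun i _ => ?_
    rw [← norm_add_sq_real]
    simp [hy]
  have hclus : 0 ≤ ∑ i, inner ℝ (y i) (H i) +
      (γ : ℝ) / 2 * ∑ i, ∑ j, if c i = c j then w i j * ‖y i - y j‖ else 0 := by
    rw [sum_eq_sum_idx c (fun i => inner ℝ (y i) (H i)), sum_eq_sum_idx c (fun i => ∑ j, _),
      Finset.mul_sum, ← Finset.sum_add_distrib]
    refine Finset.sum_nonneg fun α _ => ?_
    have h1 : ∑ i ∈ idx c α, (∑ j, if c i = c j then w i j * ‖y i - y j‖ else 0) =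
        ∑ i ∈ idx c α, ∑ j ∈ idx c α, w i j * ‖y i - y j‖ := by
      refine Finset.sum_congr rfl fun i hi => ?_
      rw [← Finset.sum_filter]
      refine Finset.sum_congr ?_ fun _ _ => rfl
      ext j
      simp [mem_idx, mem_idx.1 hi, eq_comm]
    rw [h1]
    refine cluster_term_nonneg _ (hy0 α) fun i hi j hj hne => ?_
    have hc : c i = c j := (mem_idx.1 hi).trans (mem_idx.1 hj).symm
    have h2 : H i - H j = -(b i - b j) + (γ : ℝ) • (pull w c X i - pull w c X j) := by
      simp only [hH, hc]
      module
    have h3 := hγ i j hc hne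
    have h4 : ‖(γ : ℝ) • (pull w c X i - pull w c X j)‖ ≤ γ * weightGap w c (c i) i j := by
      rw [norm_smul, Real.norm_eq_abs, abs_of_nonneg γ.coe_nonneg]
      exact mul_le_mul_of_nonneg_left (norm_pull_sub_le w c X hc) γ.2
    rw [h2]
    refine (norm_add_le _ _).trans ?_
    rw [norm_neg]
    rw [mem_idx.1 hi, size] at h3
    rw [mem_idx.1 hi] at h4
    linarith
  have hHsum : ∑ i, inner ℝ (y i) (H i) = ∑ i, inner ℝ (y i) (X (c i) - b i) +
      (γ : ℝ) * ∑ i, inner ℝ (y i) (pull w c X i) := by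
    rw [Finset.mul_sum, ← Finset.sum_add_distrib]
    refine Finset.sum_congr rfl fun i _ => ?_
    rw [hH, inner_add_right, inner_smul_right]
  have hopt := hx fun i => X (c i)
  rw [objective_eq_sum_sum b hs, objective_eq_sum_sum b hs] at hopt
  have hle : ∑ i, ‖y i‖ ^ 2 ≤ 0 := by linarith
  have h0 := (Finset.sum_eq_zero_iff_of_nonneg (fun i _ => sq_nonneg ‖y i‖)).1
    (le_antisymm hle (Finset.sum_nonneg fun i _ => sq_nonneg _))
  have hxX : ∀ i, x i = X (c i) := fun i => by
    have := h0 i (Finset.mem_univ i)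
    rwa [sq_eq_zero_iff, norm_eq_zero, sub_eq_zero] at this
  rw [hxX, hxX, hij]

/-! ### Separation of the clusters -/

lemma avgWeight_nonneg {n K : ℕ} {w : Fin n → Fin n → ℝ} (hw : ∀ i j, i ≠ j → 0 ≤ w i j)
    (c : Fin n → Fin K) (α : Fin K) : 0 ≤ avgWeight w c α := by
  refine mul_nonneg (by positivity) (Finset.sum_nonneg fun l hl => Finset.sum_nonneg fun i hi =>
    Finset.sum_nonneg fun j hj => hw i j fun e => ?_)
  rw [Finset.mem_filter] at hl
  exact hl.2 (by rw [← mem_idx.1 hi, ← mem_idx.1 hj, e])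

/-- The force balance on a whole cluster, from moving it alone. -/
lemma IsOptimal.norm_sub_centroid_le {n K m : ℕ} {b : Fin n → E m} {w : Fin n → Fin n → ℝ}
    {c : Fin n → Fin K} (hs : ∀ i j, i ≠ j → w i j = w j i) (hw : ∀ i j, i ≠ j → 0 ≤ w i j)
    {γ : ℝ≥0} {x : Fin n → E m} (hx : IsOptimal b w γ x) {α : Fin K} {X : E m}
    (hα : (idx c α).Nonempty) (hX : ∀ i, c i = α → x i = X) :
    ‖X - centroid b c α‖ ≤ γ * avgWeight w c α := by
  have hN : (0 : ℝ) < size c α := by exact_mod_cast hα.card_pos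
  have hcen : ∑ i ∈ idx c α, (x i - b i) = (size c α : ℝ) • (X - centroid b c α) := by
    rw [Finset.sum_sub_distrib, Finset.sum_congr rfl fun i hi => hX i (mem_idx.1 hi),
      Finset.sum_const, smul_sub, centroid, smul_smul, mul_inv_cancel₀ hN.ne', one_smul,
      Nat.cast_smul_eq_nsmul, size]
  set e : E m := -(X - centroid b c α) with he
  have h := hx.first_order hs hw fun i => if c i = α then e else 0
  have h1 : ∑ i, inner ℝ (if c i = α then e else 0) (x i - b i) =
      -(size c α * ‖X - centroid b c α‖ ^ 2) := by
    have : ∀ i, inner ℝ (if c i = α then e else 0) (x i - b i) =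
        if c i = α then inner ℝ e (x i - b i) else (0 : ℝ) := fun i => by split_ifs <;> simp
    simp_rw [this]
    rw [← Finset.sum_filter]
    change ∑ i ∈ idx c α, inner ℝ e (x i - b i) = _
    rw [← inner_sum, hcen, he, inner_neg_left, inner_smul_right, real_inner_self_eq_norm_sq]
  set g : Fin n → Fin n → ℝ := fun i j => if c i = α then (if c j = α then 0 else w i j) else 0
    with hg
  have h2 : ∀ i j, w i j * ‖(if c i = α then e else 0) - (if c j = α then e else 0)‖ =
      (g i j + g j i) * ‖e‖ := by
    intro i j
    simp only [hg]
    split_ifs with hi hj hj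
    · simp
    · simp
    · have hne : i ≠ j := fun e => hi (by rw [e, hj])
      simp [hs i j hne]
    · simp
  have h3 : ∑ i, ∑ j, g i j = size c α * avgWeight w c α := by
    rw [avgWeight, ← mul_assoc, mul_inv_cancel₀ hN.ne', one_mul]
    simp only [clusterWeight]
    conv_rhs => rw [Finset.sum_comm, idx, Finset.sum_filter]
    refine Finset.sum_congr rfl fun i _ => ?_
    simp only [hg]
    split_ifs with hi
    · rw [sum_eq_sum_idx c, Finset.sum_filter]
      refine Finset.sum_congr rfl fun β _ => ?_
      split_ifs with hβ
      · refine Finset.sum_congr rfl fun j hj => ?_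
        rw [if_neg]
        rwa [mem_idx.1 hj]
      · refine Finset.sum_eq_zero fun j hj => ?_
        rw [if_pos]
        rw [mem_idx.1 hj]
        exact not_not.1 hβ
    · simp
  have h4 : ∑ i, ∑ j, w i j * ‖(if c i = α then e else 0) - (if c j = α then e else 0)‖ =
      2 * (size c α * avgWeight w c α) * ‖e‖ := by
    simp_rw [h2, ← Finset.sum_mul, Finset.sum_add_distrib]
    rw [Finset.sum_comm (f := fun i j => g j i), h3]
    ring
  rw [h1, h4, he, norm_neg] at h
  by_contra! hlt
  have hpos : 0 < ‖X - centroid b c α‖ :=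
    lt_of_le_of_lt (mul_nonneg γ.2 (avgWeight_nonneg hw c α)) hlt
  have := mul_lt_mul_of_pos_left hlt (mul_pos hN hpos)
  linarith

/-- A constant optimal solution is the mean of the data, from moving all points together. -/
lemma IsOptimal.eq_mean {n m : ℕ} {b : Fin n → E m} {w : Fin n → Fin n → ℝ}
    (hs : ∀ i j, i ≠ j → w i j = w j i) (hw : ∀ i j, i ≠ j → 0 ≤ w i j) (hn : 0 < n)
    {γ : ℝ≥0} {x : Fin n → E m} (hx : IsOptimal b w γ x) {X : E m} (hX : ∀ i, x i = X) :
    X = mean b := by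
  have hn' : (0 : ℝ) < n := by exact_mod_cast hn
  have hsum : ∑ i, (x i - b i) = (n : ℝ) • (X - mean b) := by
    rw [Finset.sum_sub_distrib, Finset.sum_congr rfl fun i _ => hX i, Finset.sum_const, smul_sub,
      mean, smul_smul, mul_inv_cancel₀ hn'.ne', one_smul, Nat.cast_smul_eq_nsmul, Finset.card_univ,
      Fintype.card_fin]
  have h := hx.first_order hs hw fun _ => -(X - mean b)
  simp only [sub_self, norm_zero, mul_zero, Finset.sum_const_zero, add_zero] at h
  rw [← inner_sum, hsum, inner_neg_left, inner_smul_right, real_inner_self_eq_norm_sq] at h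
  have h0 : ‖X - mean b‖ ^ 2 ≤ 0 := by
    by_contra! hlt
    have := mul_pos hn' hlt
    linarith
  rw [← sub_eq_zero, ← norm_eq_zero, ← sq_eq_zero_iff]
  exact le_antisymm h0 (sq_nonneg _)

theorem solutionSatisfies_perfectlyRecovers {n K m : ℕ} {b : Fin n → E m} {w : Fin n → Fin n → ℝ}
    {c : Fin n → Fin K} (hs : ∀ i j, i ≠ j → w i j = w j i) (hw : ∀ i j, i ≠ j → 0 ≤ w i j)
    {γ : ℝ≥0}
    (hγ : ∀ i j, c i = c j → i ≠ j →
      ‖b i - b j‖ ≤ γ * ((size c (c i) : ℝ) * w i j - weightGap w c (c i) i j))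
    (hsep : ∀ α β, α < β →
      γ * (avgWeight w c α + avgWeight w c β) < ‖centroid b c α - centroid b c β‖) :
    SolutionSatisfies b w γ fun x => PerfectlyRecovers x c := by
  obtain ⟨x, hx⟩ := exists_isOptimal b hw γ
  refine ⟨x, hx, fun y hy => hx.unique hw hy, fun i j =>
    ⟨fun h => ?_, fun h => hx.eq_of_same_cluster hs hw hγ h⟩⟩
  have key : ∀ i j, x i = x j → ¬ c i < c j := by
    intro i j h hlt
    have hi := hx.norm_sub_centroid_le hs hw (c := c) (α := c i) (X := x i) ⟨i, mem_idx.2 rfl⟩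
      fun k hk => hx.eq_of_same_cluster hs hw hγ hk
    have hj := hx.norm_sub_centroid_le hs hw (c := c) (α := c j) (X := x j) ⟨j, mem_idx.2 rfl⟩
      fun k hk => hx.eq_of_same_cluster hs hw hγ hk
    have h1 := hsep _ _ hlt
    have h2 := norm_sub_le_norm_sub_add_norm_sub (centroid b c (c i)) (x i) (centroid b c (c j))
    rw [norm_sub_rev] at hi
    rw [← h] at hj
    linarith
  rcases lt_trichotomy (c i) (c j) with h1 | h1 | h1
  · exact absurd h1 (key i j h)
  · exact h1
  · exact absurd h1 (key j i h.symm)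

/-- A solution that is constant on clusters recovers the partition into its level sets, which is a
coarsening of the clustering. -/
lemma recoversNontrivialCoarsening_of_ne {n K m : ℕ} {c : Fin n → Fin K}
    (hc : Function.Surjective c) {x : Fin n → E m} (hx : ∀ i j, c i = c j → x i = x j)
    {i₀ j₀ : Fin n} (hne : x i₀ ≠ x j₀) : RecoversNontrivialCoarsening x c := by
  classical
  set T : Finset (E m) := Finset.univ.image x
  have hT : ∀ i, x i ∈ T := fun i => Finset.mem_image_of_mem _ (Finset.mem_univ i)
  set f : Fin n → Fin T.card := fun i => T.equivFin ⟨x i, hT i⟩ with hf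
  have hfx : ∀ i j, f i = f j ↔ x i = x j := fun i j => by simp [hf]
  obtain ⟨s, hs⟩ := hc.hasRightInverse
  refine ⟨T.card, f, ⟨Finset.one_lt_card.2 ⟨_, hT i₀, _, hT j₀, hne⟩, fun α => f (s α), ?_, ?_⟩,
    fun i j => (hfx i j).symm⟩
  · intro l
    obtain ⟨i, -, hi⟩ := Finset.mem_image.1 (T.equivFin.symm l).2
    refine ⟨c i, ?_⟩
    have h1 : f (s (c i)) = f i := (hfx _ _).2 (hx _ _ (hs (c i)))
    change f (s (c i)) = l
    rw [h1, hf]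
    simp [hi]
  · exact fun i => (hfx _ _).2 (hx _ _ (hs (c i)).symm)

theorem solutionSatisfies_recoversNontrivialCoarsening {n K m : ℕ} {b : Fin n → E m}
    {w : Fin n → Fin n → ℝ} {c : Fin n → Fin K} (hc : Function.Surjective c)
    (hs : ∀ i j, i ≠ j → w i j = w j i) (hw : ∀ i j, i ≠ j → 0 ≤ w i j) {γ : ℝ≥0}
    (hγ : ∀ i j, c i = c j → i ≠ j →
      ‖b i - b j‖ ≤ γ * ((size c (c i) : ℝ) * w i j - weightGap w c (c i) i j))
    {α : Fin K} (hsep : γ * avgWeight w c α < ‖mean b - centroid b c α‖) :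
    SolutionSatisfies b w γ fun x => RecoversNontrivialCoarsening x c := by
  obtain ⟨x, hx⟩ := exists_isOptimal b hw γ
  refine ⟨x, hx, fun y hy => hx.unique hw hy, ?_⟩
  obtain ⟨i, rfl⟩ := hc α
  by_cases hall : ∀ j, x j = x i
  · have hmean := hx.eq_mean hs hw i.pos hall
    have h := hx.norm_sub_centroid_le hs hw (c := c) (α := c i) (X := x i) ⟨i, mem_idx.2 rfl⟩
      fun k _ => hall k
    rw [hmean] at h
    exact absurd hsep h.not_gt
  · push Not at hall
    obtain ⟨j, hj⟩ := hall
    exact recoversNontrivialCoarsening_of_ne hc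
      (fun _ _ h => hx.eq_of_same_cluster hs hw hγ h) hj

/-! ### Random projections of the data -/

/-- The projection as a linear map. -/
noncomputable def projLin {m d : ℕ} (P : Matrix (Fin m) (Fin d) ℝ) : E d →ₗ[ℝ] E m where
  toFun := proj P
  map_add' x y := by simp [proj, Matrix.mulVec_add]
  map_smul' r x := by simp [proj, Matrix.mulVec_smul]

lemma projLin_apply {m d : ℕ} (P : Matrix (Fin m) (Fin d) ℝ) (z : E d) :
    projLin P z = proj P z := rfl

lemma centroid_proj {n K m d : ℕ} (P : Matrix (Fin m) (Fin d) ℝ) (a : Fin n → E d)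
    (c : Fin n → Fin K) (α : Fin K) :
    centroid (fun i => proj P (a i)) c α = proj P (centroid a c α) := by
  simp only [centroid, ← projLin_apply, map_smul, map_sum]

lemma mean_proj {n m d : ℕ} (P : Matrix (Fin m) (Fin d) ℝ) (a : Fin n → E d) :
    mean (fun i => proj P (a i)) = proj P (mean a) := by
  simp only [mean, ← projLin_apply, map_smul, map_sum]

lemma proj_sub {m d : ℕ} (P : Matrix (Fin m) (Fin d) ℝ) (x y : E d) :
    proj P (x - y) = proj P x - proj P y := map_sub (projLin P) x y

/-- The event that `Π` is an `ε`-isometry on the vector `v`. -/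
def isometryOn {d : ℕ} (m : ℕ) (ε : ℝ) (v : E d) : Set (Matrix (Fin m) (Fin d) ℝ) :=
  {P | (1 - ε) * ‖v‖ ^ 2 ≤ ‖proj P v‖ ^ 2 ∧ ‖proj P v‖ ^ 2 ≤ (1 + ε) * ‖v‖ ^ 2}

lemma measurableSet_isometryOn {d : ℕ} (m : ℕ) (ε : ℝ) (v : E d) :
    MeasurableSet (isometryOn m ε v) := by
  have h : Measurable fun P : Matrix (Fin m) (Fin d) ℝ => ‖proj P v‖ ^ 2 :=
    (measurable_proj v).norm.pow_const 2
  exact (measurableSet_le measurable_const h).inter (measurableSet_le h measurable_const)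

lemma isometryOn_sub_comm {d : ℕ} (m : ℕ) (ε : ℝ) (u v : E d) :
    isometryOn m ε (u - v) = isometryOn m ε (v - u) := by
  ext P
  simp only [isometryOn, Set.mem_ofPred_eq, proj_sub]
  rw [norm_sub_rev u, norm_sub_rev (proj P u)]

lemma measurableSet_withinClusterIsometry {n K d : ℕ} (m : ℕ) (a : Fin n → E d)
    (c : Fin n → Fin K) (ε : ℝ) : MeasurableSet (withinClusterIsometry m a c ε) := by
  have : withinClusterIsometry m a c ε =
      ⋂ (i) (j) (_ : c i = c j), isometryOn m ε (a i - a j) := by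
    ext P
    simp [withinClusterIsometry, isometryOn]
  rw [this]
  exact .iInter fun i => .iInter fun j => .iInter fun _ => measurableSet_isometryOn m ε _

lemma IsDJL.measureReal_compl_isometryOn_le {m d : ℕ} {ε δ : ℝ}
    {D : Measure (Matrix (Fin m) (Fin d) ℝ)} (hD : IsDJL ε δ D) (hδ : 0 ≤ δ) (v : E d) :
    D.real (isometryOn m ε v)ᶜ ≤ δ := by
  have := hD.isProbabilityMeasure
  rcases eq_or_ne v 0 with rfl | hv
  · have h0 : (isometryOn m ε (0 : E d))ᶜ = ∅ := by
      rw [Set.compl_empty_iff, Set.eq_univ_iff_forall]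
      intro P
      have : proj P (0 : E d) = 0 := map_zero (projLin P)
      simp [isometryOn, this]
    simpa [h0] using hδ
  have hv' : ‖v‖ ≠ 0 := norm_ne_zero_iff.2 hv
  set z : E d := ‖v‖⁻¹ • v with hz
  have hz1 : ‖z‖ = 1 := by rw [hz, norm_smul, norm_inv, norm_norm, inv_mul_cancel₀ hv']
  have hsub : (isometryOn m ε v)ᶜ ⊆ {P | ε < |‖proj P z‖ ^ 2 - 1|} := by
    intro P hP
    by_contra hle
    refine hP ?_
    rw [Set.mem_ofPred_eq, not_lt] at hle
    have hle' := abs_le.1 hle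
    have hPv : ‖proj P v‖ ^ 2 = ‖proj P z‖ ^ 2 * ‖v‖ ^ 2 := by
      have : proj P v = ‖v‖ • proj P z := by
        have h := (projLin P).map_smul ‖v‖ z
        rwa [hz, smul_smul, mul_inv_cancel₀ hv', one_smul] at h
      rw [this, norm_smul, norm_norm, mul_pow, mul_comm]
    have hv2 := sq_nonneg ‖v‖
    constructor
    · rw [hPv]
      exact mul_le_mul_of_nonneg_right (by linarith) hv2
    · rw [hPv]
      exact mul_le_mul_of_nonneg_right (by linarith) hv2
  refine (measureReal_mono hsub).trans ?_
  exact ENNReal.toReal_le_of_le_ofReal hδ (hD.tail z hz1).le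

/-- The union bound over the `(N² - N) / 2` pairs of vectors of a family. -/
lemma IsDJL.measureReal_compl_pairs_le {N m d : ℕ} {ε δ : ℝ}
    {D : Measure (Matrix (Fin m) (Fin d) ℝ)} (hD : IsDJL ε δ D) (hδ : 0 ≤ δ) (v : Fin N → E d) :
    D.real (⋂ (i) (j), isometryOn m ε (v i - v j))ᶜ ≤ ((N : ℝ) ^ 2 - N) / 2 * δ := by
  have := hD.isProbabilityMeasure
  have hsub : (⋂ (i) (j), isometryOn m ε (v i - v j))ᶜ ⊆
      ⋃ i ∈ Finset.univ, ⋃ j ∈ Finset.Ioi i, (isometryOn m ε (v i - v j))ᶜ := by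
    intro P hP
    simp only [Set.compl_iInter, Set.mem_iUnion] at hP
    obtain ⟨i, j, hij⟩ := hP
    simp only [Set.mem_iUnion]
    rcases lt_trichotomy i j with h | rfl | h
    · exact ⟨i, Finset.mem_univ i, j, Finset.mem_Ioi.2 h, hij⟩
    · have h0 : proj P (0 : E d) = 0 := map_zero (projLin P)
      exact absurd (by simp [isometryOn, h0]) hij
    · rw [isometryOn_sub_comm] at hij
      exact ⟨j, Finset.mem_univ j, i, Finset.mem_Ioi.2 h, hij⟩
  have hcard := sum_sum_eq_two_mul_sum_Ioi (n := N) (fun i j => if i = j then 0 else δ)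
    (fun i j => by simp only [eq_comm]) (by simp)
  have hL : ∑ i : Fin N, ∑ j : Fin N, (if i = j then 0 else δ) = ((N : ℝ) ^ 2 - N) * δ := by
    have h1 : ∀ i j : Fin N, (if i = j then 0 else δ) = δ - if i = j then δ else 0 := by
      intro i j; split_ifs <;> simp
    simp_rw [h1, Finset.sum_sub_distrib, Finset.sum_ite_eq, Finset.sum_const]
    simp
    ring
  have hR : ∑ i : Fin N, ∑ j ∈ Finset.Ioi i, (if i = j then 0 else δ) =
      ∑ i : Fin N, ∑ j ∈ Finset.Ioi i, δ :=
    Finset.sum_congr rfl fun i _ => Finset.sum_congr rfl fun j hj =>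
      if_neg (Finset.mem_Ioi.1 hj).ne
  calc _ ≤ D.real (⋃ i ∈ Finset.univ, ⋃ j ∈ Finset.Ioi i, (isometryOn m ε (v i - v j))ᶜ) :=
        measureReal_mono hsub (measure_ne_top _ _)
    _ ≤ ∑ i, ∑ j ∈ Finset.Ioi i, D.real (isometryOn m ε (v i - v j))ᶜ :=
        (measureReal_biUnion_finset_le _ _).trans
          (Finset.sum_le_sum fun i _ => measureReal_biUnion_finset_le _ _)
    _ ≤ ∑ i : Fin N, ∑ j ∈ Finset.Ioi i, δ :=
        Finset.sum_le_sum fun i _ => Finset.sum_le_sum fun j _ =>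
          hD.measureReal_compl_isometryOn_le hδ _
    _ = _ := by rw [← hR]; linarith

/-- `P(E₂ᶜ | E₁) ≤ P(E₂ᶜ) / P(E₁)`, with `n ^ p` divided out. -/
lemma one_sub_inv_le_cond {Ω : Type*} [MeasurableSpace Ω] {D : Measure Ω} [IsProbabilityMeasure D]
    {n : ℕ} {p : ℝ} (hn : 2 ≤ n) (hp : 2 < p) {E₁ E₂ S : Set Ω} (h1 : MeasurableSet E₁)
    (hS : E₁ ∩ E₂ ⊆ S)
    (hE₁ : D.real E₁ᶜ ≤ ((n : ℝ) ^ 2 - n) / 2 * (2 / (n : ℝ) ^ p))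
    (hE₂ : D.real E₂ᶜ ≤ n / (n : ℝ) ^ p) :
    1 - 1 / ((n : ℝ) ^ (p - 1) - n + 1) ≤ (ProbabilityTheory.cond D E₁).real S := by
  have hn0 : (0 : ℝ) < n := by positivity
  have hn1 : (1 : ℝ) ≤ n := by exact_mod_cast (by omega : 1 ≤ n)
  set q := (n : ℝ) ^ (p - 1) with hq
  have hnp : (n : ℝ) ^ p = n * q := by
    rw [hq, mul_comm, ← Real.rpow_add_one hn0.ne']
    congr 1
    ring
  have hqn : (n : ℝ) ≤ q := by
    rw [hq]
    exact Real.self_le_rpow_of_one_le hn1 (by linarith)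
  have hq0 : 0 < q := hn0.trans_le hqn
  have hE₁' : D.real E₁ᶜ ≤ (n - 1) / q := by
    refine hE₁.trans_eq ?_
    rw [hnp]
    field_simp
  have hE₂' : D.real E₂ᶜ ≤ 1 / q := by
    refine hE₂.trans_eq ?_
    rw [hnp]
    field_simp
  rw [probReal_compl_eq_one_sub h1] at hE₁'
  have hlow : (q - n + 1) / q ≤ D.real E₁ := by
    have : (q - n + 1) / q = 1 - (n - 1) / q := by field_simp; ring
    linarith
  have hpos : 0 < D.real E₁ := lt_of_lt_of_le (div_pos (by linarith) hq0) hlow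
  have hD0 : D E₁ ≠ 0 := fun h => by simp [measureReal_def, h] at hpos
  have := cond_isProbabilityMeasure hD0
  refine le_trans ?_ (measureReal_mono hS)
  rw [measureReal_def, cond_apply h1, ENNReal.toReal_mul, ENNReal.toReal_inv,
    ← Set.inter_assoc, Set.inter_self]
  have hint : D.real E₁ - D.real E₂ᶜ ≤ D.real (E₁ ∩ E₂) := by
    have h3 : D.real E₁ ≤ D.real (E₁ ∩ E₂) + D.real E₂ᶜ :=
      (measureReal_mono fun ω hω => by
        by_cases h : ω ∈ E₂
        · exact Or.inl ⟨hω, h⟩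
        · exact Or.inr h).trans (measureReal_union_le _ _)
    linarith
  have hratio : D.real E₂ᶜ / D.real E₁ ≤ 1 / (q - n + 1) := by
    rw [div_le_div_iff₀ hpos (by linarith)]
    have h3 := mul_le_mul_of_nonneg_right hE₂' (show 0 ≤ q - n + 1 by linarith)
    have h4 : 1 / q * (q - n + 1) = (q - n + 1) / q := by ring
    linarith
  calc 1 - 1 / (q - n + 1) ≤ 1 - D.real E₂ᶜ / D.real E₁ := by linarith
    _ = (D.real E₁)⁻¹ * (D.real E₁ - D.real E₂ᶜ) := by field_simp
    _ ≤ _ := mul_le_mul_of_nonneg_left hint (inv_nonneg.2 hpos.le)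

/-! ### Thresholds -/

lemma lt_epsSup {e : ℝ} (h1 : e < 1) {r : ℝ≥0∞}
    (h : ENNReal.ofReal (Real.sqrt ((1 + e) / (1 - e))) < r) : e < epsSup r := by
  unfold epsSup
  split_ifs with hr
  · exact h1
  rw [ENNReal.ofReal_lt_iff_lt_toReal (Real.sqrt_nonneg _) hr] at h
  have h2 := Real.lt_sq_of_sqrt_lt h
  rw [div_lt_iff₀ (by linarith)] at h2
  rw [lt_div_iff₀ (by positivity)]
  linarith

lemma epsSup_le_one (r : ℝ≥0∞) : epsSup r ≤ 1 := by
  unfold epsSup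
  split_ifs
  · exact le_rfl
  · rw [div_le_one (by positivity)]
    linarith

lemma mul_le_of_gammaMin_le {n K d : ℕ} {a : Fin n → E d} {w : Fin n → Fin n → ℝ}
    {c : Fin n → Fin K} (hwc : WeightCondition w c) {s : ℝ} (hs : 0 ≤ s) {γ : ℝ≥0}
    (h : ENNReal.ofReal s * gammaMin a w c ≤ γ) {i j : Fin n} (hc : c i = c j) (hij : i ≠ j) :
    s * ‖a i - a j‖ ≤ γ * ((size c (c i) : ℝ) * w i j - weightGap w c (c i) i j) := by
  have hi : i ∈ idx c (c i) := mem_idx.2 rfl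
  have hj : j ∈ idx c (c i) := mem_idx.2 hc.symm
  have hpos : 0 < (size c (c i) : ℝ) * w i j - weightGap w c (c i) i j :=
    sub_pos.2 (hwc (c i) i hi j hj hij).2
  have hle : ENNReal.ofReal ‖a i - a j‖ /
      ENNReal.ofReal ((size c (c i) : ℝ) * w i j - weightGap w c (c i) i j) ≤ gammaMin a w c :=
    le_iSup_of_le (c i) (le_iSup₂_of_le i hi (le_iSup₂_of_le j hj le_rfl))
  have h2 := (mul_le_mul_right hle (ENNReal.ofReal s)).trans h
  rw [← ENNReal.ofReal_div_of_pos hpos, ← ENNReal.ofReal_mul hs, ← ENNReal.ofReal_coe_nnreal,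
    ENNReal.ofReal_le_ofReal_iff γ.coe_nonneg, ← mul_div_assoc, div_le_iff₀ hpos] at h2
  exact h2

/-- The strict inequality between real numbers behind `γ < s * (A / B)` in the extended reals, which
also holds in the case `B = 0`, where `A / B = ∞`. -/
lemma mul_lt_of_lt_ofReal_mul_div {γ : ℝ≥0} {s A B : ℝ} (hs : 0 < s) (hA : 0 < A) (hB : 0 ≤ B)
    (h : (γ : ℝ≥0∞) < ENNReal.ofReal s * (ENNReal.ofReal A / ENNReal.ofReal B)) :
    γ * B < s * A := by
  rcases hB.eq_or_lt with rfl | hB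
  · simpa using mul_pos hs hA
  rw [← ENNReal.ofReal_div_of_pos hB, ← ENNReal.ofReal_mul hs.le, ← ENNReal.ofReal_coe_nnreal,
    ENNReal.ofReal_lt_ofReal_iff (by positivity), ← mul_div_assoc, lt_div_iff₀ hB] at h
  exact h

lemma sqrt_mul_norm_le_norm_proj {m d : ℕ} {ε : ℝ} {v : E d} {P : Matrix (Fin m) (Fin d) ℝ}
    (h : P ∈ isometryOn m ε v) (hε : ε ≤ 1) : √(1 - ε) * ‖v‖ ≤ ‖proj P v‖ := by
  refine le_of_sq_le_sq ?_ (norm_nonneg _)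
  rw [mul_pow, Real.sq_sqrt (by linarith)]
  exact h.1

lemma norm_proj_le_sqrt_mul_norm {m d : ℕ} {ε : ℝ} {v : E d} {P : Matrix (Fin m) (Fin d) ℝ}
    (h : P ∈ isometryOn m ε v) (hε : 0 ≤ ε) : ‖proj P v‖ ≤ √(1 + ε) * ‖v‖ := by
  refine le_of_sq_le_sq ?_ (by positivity)
  rw [mul_pow, Real.sq_sqrt (by linarith)]
  exact h.2

/-- On the event that the projection preserves the distances inside the clusters, `γ` exceeds the
lower threshold of the projected data. -/
lemma norm_proj_sub_le {n K m d : ℕ} {a : Fin n → E d} {w : Fin n → Fin n → ℝ} {c : Fin n → Fin K}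
    (hwc : WeightCondition w c) {ε : ℝ} (hε : 0 ≤ ε) {γ : ℝ≥0}
    (h : ENNReal.ofReal (Real.sqrt (1 + ε)) * gammaMin a w c ≤ γ)
    {P : Matrix (Fin m) (Fin d) ℝ} (hP : P ∈ withinClusterIsometry m a c ε)
    (i j : Fin n) (hc : c i = c j) (hij : i ≠ j) :
    ‖proj P (a i) - proj P (a j)‖ ≤
      γ * ((size c (c i) : ℝ) * w i j - weightGap w c (c i) i j) := by
  rw [← proj_sub]
  exact (norm_proj_le_sqrt_mul_norm (hP i j hc) hε).trans
    (mul_le_of_gammaMin_le hwc (Real.sqrt_nonneg _) h hc hij)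

lemma IsDJL.measureReal_compl_withinClusterIsometry_le {n K m d : ℕ} {ε δ : ℝ}
    {D : Measure (Matrix (Fin m) (Fin d) ℝ)} (hD : IsDJL ε δ D) (hδ : 0 ≤ δ) (a : Fin n → E d)
    (c : Fin n → Fin K) :
    D.real (withinClusterIsometry m a c ε)ᶜ ≤ ((n : ℝ) ^ 2 - n) / 2 * δ := by
  have := hD.isProbabilityMeasure
  refine (measureReal_mono (Set.compl_subset_compl.2 ?_)).trans
    (hD.measureReal_compl_pairs_le hδ a)
  intro P hP i j _
  exact Set.mem_iInter₂.1 hP i j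

/-! ### Recovery with high probability -/

section Recovery

variable {n K m d : ℕ} {a : Fin n → E d} {c : Fin n → Fin K} {w : Fin n → Fin n → ℝ} {p ε : ℝ}
  {D : Measure (Matrix (Fin m) (Fin d) ℝ)} {γ : ℝ≥0}

theorem perfectlyRecovers_prob (ha : DistinctCentroids a c)
    (hs : ∀ i j, i ≠ j → w i j = w j i) (hw : ∀ i j, i ≠ j → 0 ≤ w i j)
    (hwc : WeightCondition w c) (hn : 2 ≤ n) (hK : K * (K + 1) < n) (hp : 2 < p) (hε0 : 0 ≤ ε)
    (hε1 : ε < 1) (hD : IsDJL ε (2 / (n : ℝ) ^ p) D)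
    (hmin : ENNReal.ofReal (Real.sqrt (1 + ε)) * gammaMin a w c ≤ (γ : ℝ≥0∞))
    (hmax : (γ : ℝ≥0∞) < ENNReal.ofReal (Real.sqrt (1 - ε)) * gammaMax a w c) :
    1 - 1 / ((n : ℝ) ^ (p - 1) - n + 1) ≤
      (ProbabilityTheory.cond D (withinClusterIsometry m a c ε)).real
        {P | SolutionSatisfies (fun i => proj P (a i)) w γ (fun x => PerfectlyRecovers x c)} := by
  have := hD.isProbabilityMeasure
  have hδ : 0 ≤ 2 / (n : ℝ) ^ p := by positivity
  refine one_sub_inv_le_cond hn hp (measurableSet_withinClusterIsometry m a c ε)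
    (E₂ := ⋂ (α) (β), isometryOn m ε (centroid a c α - centroid a c β))
    ?_
    (hD.measureReal_compl_withinClusterIsometry_le hδ a c)
    ((hD.measureReal_compl_pairs_le hδ (centroid a c)).trans ?_)
  · rintro P ⟨hP1, hP2⟩
    refine solutionSatisfies_perfectlyRecovers hs hw (norm_proj_sub_le hwc hε0 hmin hP1)
      fun α β hαβ => ?_
    rw [centroid_proj, centroid_proj, ← proj_sub]
    refine lt_of_lt_of_le ?_ (sqrt_mul_norm_le_norm_proj (Set.mem_iInter₂.1 hP2 α β) hε1.le)
    refine mul_lt_of_lt_ofReal_mul_div (Real.sqrt_pos.2 (by linarith))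
      (norm_pos_iff.2 (sub_ne_zero.2 (ha.1.ne hαβ.ne)))
      (add_nonneg (avgWeight_nonneg hw c α) (avgWeight_nonneg hw c β)) (hmax.trans_le ?_)
    gcongr
    exact iInf_le_of_le α (iInf₂_le β hαβ)
  · have hK' : (K : ℝ) * (K + 1) < n := by exact_mod_cast hK
    have hK0 : (0 : ℝ) ≤ K := Nat.cast_nonneg K
    rw [div_mul_div_comm, mul_comm (2 : ℝ), mul_div_mul_right _ _ two_ne_zero]
    gcongr
    nlinarith

/-- A single cluster `α` with `γ < √(1 - ε) ‖a^(0) - a^(α)‖ / w̄^(α)` rules out the constant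
solution, so only one vector has to be nearly preserved in addition to the distances inside the
clusters. -/
theorem recoversNontrivialCoarsening_prob (hc : Function.Surjective c) (ha : DistinctCentroids a c)
    (hs : ∀ i j, i ≠ j → w i j = w j i) (hw : ∀ i j, i ≠ j → 0 ≤ w i j)
    (hwc : WeightCondition w c) (hn : 2 ≤ n) (hp : 2 < p) (hε0 : 0 ≤ ε)
    (hε1 : ε < 1) (hD : IsDJL ε (2 / (n : ℝ) ^ p) D)
    (hmin : ENNReal.ofReal (Real.sqrt (1 + ε)) * gammaMin a w c ≤ (γ : ℝ≥0∞))
    (hmax : (γ : ℝ≥0∞) < ENNReal.ofReal (Real.sqrt (1 - ε)) * gammaMax2 a w c) :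
    1 - 1 / ((n : ℝ) ^ (p - 1) - n + 1) ≤
      (ProbabilityTheory.cond D (withinClusterIsometry m a c ε)).real
        {P | SolutionSatisfies (fun i => proj P (a i)) w γ
          (fun x => RecoversNontrivialCoarsening x c)} := by
  have := hD.isProbabilityMeasure
  have hδ : 0 ≤ 2 / (n : ℝ) ^ p := by positivity
  rw [gammaMax2, ENNReal.mul_iSup, lt_iSup_iff] at hmax
  obtain ⟨α, hα⟩ := hmax
  refine one_sub_inv_le_cond hn hp (measurableSet_withinClusterIsometry m a c ε)
    (E₂ := isometryOn m ε (mean a - centroid a c α)) ?_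
    (hD.measureReal_compl_withinClusterIsometry_le hδ a c)
    ((hD.measureReal_compl_isometryOn_le hδ _).trans ?_)
  · rintro P ⟨hP1, hP2⟩
    refine solutionSatisfies_recoversNontrivialCoarsening hc hs hw
      (norm_proj_sub_le hwc hε0 hmin hP1) (α := α) ?_
    rw [centroid_proj, mean_proj, ← proj_sub]
    exact lt_of_lt_of_le (mul_lt_of_lt_ofReal_mul_div (Real.sqrt_pos.2 (by linarith))
      (norm_pos_iff.2 (sub_ne_zero.2 (ha.2 α).symm)) (avgWeight_nonneg hw c α) hα)
      (sqrt_mul_norm_le_norm_proj hP2 hε1.le)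
  · gcongr
    exact_mod_cast hn

end Recovery

end ConvexClustering

theorem mainTheorem4 :
    ∃ C₀ : ℝ, 0 < C₀ ∧ ∀ C : ℝ, C₀ ≤ C →
      ∀ (n K d : ℕ) (a : Fin n → E d) (c : Fin n → Fin K) (w : Fin n → Fin n → ℝ) (p : ℝ),
        Function.Surjective c →
        DistinctCentroids a c →
        (∀ i j, i ≠ j → w i j = w j i) →
        (∀ i j, i ≠ j → 0 ≤ w i j) →
        WeightCondition w c →
        K * (K + 1) < n →
        2 < p →
        epsMin C p n d < 1 →
        -- distributions with the required target dimension exist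
        (∀ ε : ℝ, 0 < ε → ε < 1 →
          ∃ m : ℕ, 1 ≤ m ∧ (m : ℝ) ≤ C * p * Real.log n / ε ^ 2 ∧
            ∃ D : Measure (Matrix (Fin m) (Fin d) ℝ), IsDJL ε (2 / (n : ℝ) ^ p) D) ∧
        -- perfect recovery
        (ENNReal.ofReal (Real.sqrt ((1 + epsMin C p n d) / (1 - epsMin C p n d))) < ratio a w c →
          epsMin C p n d < epsSup (ratio a w c) ∧
          ∀ ε : ℝ, epsMin C p n d ≤ ε → ε < epsSup (ratio a w c) →
          ∀ m : ℕ, 1 ≤ m → (m : ℝ) ≤ C * p * Real.log n / ε ^ 2 →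
          ∀ D : Measure (Matrix (Fin m) (Fin d) ℝ), IsDJL ε (2 / (n : ℝ) ^ p) D →
          ∀ γ : ℝ≥0,
            ENNReal.ofReal (Real.sqrt (1 + ε)) * gammaMin a w c ≤ (γ : ℝ≥0∞) →
            (γ : ℝ≥0∞) < ENNReal.ofReal (Real.sqrt (1 - ε)) * gammaMax a w c →
            1 - 1 / ((n : ℝ) ^ (p - 1) - n + 1) ≤
              (ProbabilityTheory.cond D (withinClusterIsometry m a c ε)).real
                {P | SolutionSatisfies (fun i => proj P (a i)) w γ
                  (fun x => PerfectlyRecovers x c)}) ∧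
        -- recovery of a non-trivial coarsening
        (ENNReal.ofReal (Real.sqrt ((1 + epsMin C p n d) / (1 - epsMin C p n d))) < ratio2 a w c →
          epsMin C p n d < epsSup (ratio2 a w c) ∧
          ∀ ε : ℝ, epsMin C p n d ≤ ε → ε < epsSup (ratio2 a w c) →
          ∀ m : ℕ, 1 ≤ m → (m : ℝ) ≤ C * p * Real.log n / ε ^ 2 →
          ∀ D : Measure (Matrix (Fin m) (Fin d) ℝ), IsDJL ε (2 / (n : ℝ) ^ p) D →
          ∀ γ : ℝ≥0,
            ENNReal.ofReal (Real.sqrt (1 + ε)) * gammaMin a w c ≤ (γ : ℝ≥0∞) →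
            (γ : ℝ≥0∞) < ENNReal.ofReal (Real.sqrt (1 - ε)) * gammaMax2 a w c →
            1 - 1 / ((n : ℝ) ^ (p - 1) - n + 1) ≤
              (ProbabilityTheory.cond D (withinClusterIsometry m a c ε)).real
                {P | SolutionSatisfies (fun i => proj P (a i)) w γ
                  (fun x => RecoversNontrivialCoarsening x c)}) := by
  -- With 32 the Gaussian matrix with `⌊C p log n / ε²⌋` rows has tails below `2 / n ^ p`.
  refine ⟨32, by norm_num, ?_⟩
  intro C hC n K d a c w p hc ha hs hw hwc hK hp he1
  have hn0 : 0 < n := by omega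
  have hK1 : 1 ≤ K := Fin.pos (c ⟨0, hn0⟩)
  have hn3 : 3 ≤ n := by nlinarith
  have he0 : 0 ≤ epsMin C p n d := Real.sqrt_nonneg _
  refine ⟨fun ε h0 h1 => exists_isDJL hC hp hn3 d h0 h1, fun hr => ⟨lt_epsSup he1 hr, ?_⟩,
    fun hr => ⟨lt_epsSup he1 hr, ?_⟩⟩
  · intro ε hε hε' m _ _ D hD γ hmin hmax
    exact perfectlyRecovers_prob ha hs hw hwc (by omega) hK hp (he0.trans hε)
      (hε'.trans_le (epsSup_le_one _)) hD hmin hmax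
  · intro ε hε hε' m _ _ D hD γ hmin hmax
    exact recoversNontrivialCoarsening_prob hc ha hs hw hwc (by omega) hp (he0.trans hε)
      (hε'.trans_le (epsSup_le_one _)) hD hmin hmax
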